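/- Work in the category of symmetric spectra (of simplicial sets), with "equivalence" meaning stable equivalence, and write $X\simeq Y$ if $X$ and $Y$ are connected by a zigzag of stable equivalences. Let $M$ be a (strictly) commutative square of symmetric spectra with maps $$\alpha:M_{00}\to M_{01},\quad \beta:M_{00}\to M_{10},\quad \gamma:M_{10}\to M_{11},\quad \delta:M_{01}\to M_{11},\qquad \gamma\beta=\delta\alpha .$$ Suppose there exists a map of symmetric spectra $s:M_{11}\to M_{10}$ such that $\gamma s=\mathrm{Id}_{M_{11}}$ and such that the map $\beta\vee s:M_{00}\vee M_{11}\to M_{10}$, given by $\beta$ on the first and by $s$ on the second wedge summand, is an equivalence. Let $C_2M$ be the $2$-cofiber (total cofiber) of the square, i.e. the homotopy cofiber of the map from the homotopy cofiber of $\beta$ to the homotopy cofiber of $\delta$ induced by $\alpha$ and $\gamma$. Then $$C_2 M\simeq \Sigma M_{01}.$$ -/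

import Mathlib

open CategoryTheory MonoidalCategory

universe u

noncomputable section

/-! ### Weak equivalences of simplicial sets -/

namespace SSet

/-- The standard simplex `Δ[1]`. -/
abbrev Δ1 : SSet.{u} := stdSimplex.obj (SimplexCategory.mk 1)

/-- Homotopy classes of maps `X ⟶ Z`, i.e. `π₀` of the mapping space: maps modulo the equivalence
relation generated by simplicial homotopies `X × Δ[1] ⟶ Z`. -/
def HoClass (X Z : SSet.{u}) : Type u :=
  Quot (fun f g : X ⟶ Z => Nonempty (Homotopy f g))

/-- Precomposition with `f` on homotopy classes. -/
def HoClass.precomp {X Y : SSet.{u}} (f : X ⟶ Y) (Z : SSet.{u}) : HoClass Y Z → HoClass X Z :=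
  Quot.lift (fun g => Quot.mk _ (f ≫ g)) (by
    rintro g g' ⟨H⟩
    exact Quot.sound ⟨{ h := (f ▷ Δ1) ≫ H.h
                        h₀ := by
                          rw [ι₀_comp_assoc, Homotopy.h₀]
                          rfl
                        h₁ := by
                          rw [ι₁_comp_assoc, Homotopy.h₁]
                          rfl
                        rel := by
                          ext _ ⟨⟨_, hx⟩, _⟩
                          exact hx.elim }⟩)

/-- A map of simplicial sets is a weak equivalence if it induces a bijection on homotopy classes of
maps into every Kan complex. -/
def IsWeakEquiv {X Y : SSet.{u}} (f : X ⟶ Y) : Prop :=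
  ∀ Z : SSet.{u}, KanComplex Z → Function.Bijective (HoClass.precomp f Z)

end SSet

/-! ### Pointed simplicial sets -/

/-- A pointed simplicial set: `pt k` is the base point, seen as a degenerate simplex of each
dimension. -/
structure PSSet where
  toSSet : SSet.{u}
  pt : ∀ k : SimplexCategoryᵒᵖ, toSSet.obj k
  map_pt : ∀ {k l : SimplexCategoryᵒᵖ} (θ : k ⟶ l), toSSet.map θ (pt k) = pt l

namespace PSSet

attribute [simp] map_pt

/-- The set of `k`-simplices. -/
abbrev S (X : PSSet.{u}) (k : SimplexCategoryᵒᵖ) : Type u := X.toSSet.obj k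

/-- Base point preserving maps of pointed simplicial sets. -/
@[ext]
structure Hom (X Y : PSSet.{u}) where
  hom : X.toSSet ⟶ Y.toSSet
  app_pt : ∀ k, hom.app k (X.pt k) = Y.pt k

attribute [simp] Hom.app_pt

instance : Category PSSet.{u} where
  Hom X Y := Hom X Y
  id X := ⟨𝟙 _, fun _ => rfl⟩
  comp f g := ⟨f.hom ≫ g.hom, fun k => by simp⟩

/-- The effect of a map on `k`-simplices. -/
abbrev Hom.ap {X Y : PSSet.{u}} (f : X ⟶ Y) (k : SimplexCategoryᵒᵖ) (x : X.S k) : Y.S k :=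
  Hom.hom f |>.app k x

/-- A map of pointed simplicial sets from its values on simplices. -/
def homMk {X Y : PSSet.{u}} (f : ∀ k, X.S k → Y.S k)
    (nat : ∀ {k l : SimplexCategoryᵒᵖ} (θ : k ⟶ l) (x : X.S k),
      f l (X.toSSet.map θ x) = Y.toSSet.map θ (f k x))
    (hpt : ∀ k, f k (X.pt k) = Y.pt k) : X ⟶ Y where
  hom := { app := fun k => ↾(f k)
           naturality := fun k l θ => by
             ext x
             exact nat θ x }
  app_pt := hpt

/-- The constant simplices of `Δ[1]` are preserved by the simplicial operators. -/
theorem map_const (i : Fin 2) {k l : SimplexCategoryᵒᵖ} (θ : k ⟶ l) :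
    SSet.Δ1.{u}.map θ (SSet.stdSimplex.const 1 i k) = SSet.stdSimplex.const 1 i l := rfl

/-- The circle `S¹ = Δ[1] / ∂Δ[1]`. -/
def circle : PSSet.{u} where
  toSSet :=
    { obj := fun k => Quot (fun s t : SSet.Δ1.{u}.obj k =>
        s ∈ (SSet.boundary.{u} 1).obj k ∧
          t ∈ (SSet.boundary.{u} 1).obj k)
      map := fun θ => ↾(Quot.map (SSet.Δ1.{u}.map θ)
        (fun _ _ h => ⟨(SSet.boundary.{u} 1).map θ h.1,
          (SSet.boundary.{u} 1).map θ h.2⟩))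
      map_id := fun k => by
        ext ⟨x⟩
        exact congrArg (Quot.mk _) (by simp)
      map_comp := fun f g => by
        ext ⟨x⟩
        exact congrArg (Quot.mk _) (by simp) }
  pt k := Quot.mk _ (SSet.stdSimplex.const 1 0 k)
  map_pt _ := rfl

/-- The interval `Δ[1]`, with the vertex `1` as base point. -/
def interval : PSSet.{u} where
  toSSet := SSet.Δ1
  pt k := SSet.stdSimplex.const 1 1 k
  map_pt _ := rfl

/-- `K₊`: the simplicial set `K` with a disjoint base point. -/
def plus (K : SSet.{u}) : PSSet.{u} where
  toSSet :=
    { obj := fun k => Option (K.obj k)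
      map := fun θ => ↾(Option.map (K.map θ))
      map_id := fun k => by
        ext x
        cases x <;> simp
      map_comp := fun f g => by
        ext x
        cases x <;> simp }
  pt _ := none
  map_pt _ := rfl

/-- The relation on `X × K` that collapses the two axes. -/
inductive SmashRel (X K : PSSet.{u}) (k : SimplexCategoryᵒᵖ) : X.S k × K.S k → X.S k × K.S k → Prop
  | left (a : K.S k) : SmashRel X K k (X.pt k, a) (X.pt k, K.pt k)
  | right (x : X.S k) : SmashRel X K k (x, K.pt k) (X.pt k, K.pt k)

/-- The smash product `X ∧ K` of pointed simplicial sets. -/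
def smash (X K : PSSet.{u}) : PSSet.{u} where
  toSSet :=
    { obj := fun k => Quot (SmashRel X K k)
      map := fun {k l} θ => ↾(Quot.map (fun p => (X.toSSet.map θ p.1, K.toSSet.map θ p.2)) (by
        rintro _ _ (a | x)
        · simpa using SmashRel.left (X := X) (K.toSSet.map θ a)
        · simpa using SmashRel.right (K := K) (X.toSSet.map θ x)))
      map_id := fun k => by
        ext ⟨x⟩
        exact congrArg (Quot.mk _) (by simp)
      map_comp := fun f g => by
        ext ⟨x⟩
        exact congrArg (Quot.mk _) (by simp) }
  pt k := Quot.mk _ (X.pt k, K.pt k)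
  map_pt θ := congrArg (Quot.mk _) (by simp)

/-- The simplex `x ∧ a` of `X ∧ K`. -/
def smash.mk {X K : PSSet.{u}} {k : SimplexCategoryᵒᵖ} (x : X.S k) (a : K.S k) : (smash X K).S k :=
  Quot.mk _ (x, a)

@[simp]
theorem smash.mk_pt_left {X K : PSSet.{u}} {k : SimplexCategoryᵒᵖ} (a : K.S k) :
    smash.mk (X.pt k) a = (smash X K).pt k := Quot.sound (.left a)

@[simp]
theorem smash.mk_pt_right {X K : PSSet.{u}} {k : SimplexCategoryᵒᵖ} (x : X.S k) :
    smash.mk x (K.pt k) = (smash X K).pt k := Quot.sound (.right x)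

/-- A function out of `X ∧ K` in dimension `k`. -/
def smash.lift {X K : PSSet.{u}} {k : SimplexCategoryᵒᵖ} {T : Type u} (f : X.S k → K.S k → T) (b : T)
    (hl : ∀ a, f (X.pt k) a = b) (hr : ∀ x, f x (K.pt k) = b) : (smash X K).S k → T :=
  Quot.lift (fun p => f p.1 p.2) (by
    rintro _ _ (a | x)
    · exact (hl a).trans (hl _).symm
    · exact (hr x).trans (hr _).symm)

/-- The map `f ∧ K : X ∧ K ⟶ Y ∧ K`. -/
def smash.map {X Y : PSSet.{u}} (f : X ⟶ Y) (K : PSSet.{u}) : smash X K ⟶ smash Y K :=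
  homMk (fun k => smash.lift (fun x a => smash.mk (Hom.ap f k x) a) ((smash Y K).pt k)
      (fun a => by simp) (fun x => by simp))
    (by
      rintro k l θ ⟨x, a⟩
      exact congrArg (fun y => smash.mk y _) (NatTrans.naturality_apply (Hom.hom f) θ x))
    (fun k => by
      exact congrArg (fun y => smash.mk y _) (Hom.app_pt f k))

/-- The relation `f a ∼ g a` on `Y ⊔ Z`, for `f : A ⟶ Y` and `g : A ⟶ Z`. -/
inductive GlueRel {A Y Z : PSSet.{u}} (f : A ⟶ Y) (g : A ⟶ Z) (k : SimplexCategoryᵒᵖ) :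
    Y.S k ⊕ Z.S k → Y.S k ⊕ Z.S k → Prop
  | glue (a : A.S k) : GlueRel f g k (.inl (Hom.ap f k a)) (.inr (Hom.ap g k a))

/-- The pushout `Y ∪_A Z` of pointed simplicial sets. -/
def glue {A Y Z : PSSet.{u}} (f : A ⟶ Y) (g : A ⟶ Z) : PSSet.{u} where
  toSSet :=
    { obj := fun k => Quot (GlueRel f g k)
      map := fun {k l} θ => ↾(Quot.map (Sum.map (Y.toSSet.map θ) (Z.toSSet.map θ)) (by
        rintro _ _ ⟨a⟩
        have := GlueRel.glue (f := f) (g := g) (A.toSSet.map θ a)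
        rw [Hom.ap, Hom.ap, NatTrans.naturality_apply, NatTrans.naturality_apply] at this
        exact this))
      map_id := fun k => by
        ext ⟨x | x⟩ <;> exact congrArg (Quot.mk _) (by simp)
      map_comp := fun f g => by
        ext ⟨x | x⟩ <;> exact congrArg (Quot.mk _) (by simp) }
  pt k := Quot.mk _ (.inl (Y.pt k))
  map_pt θ := congrArg (Quot.mk _) (by simp)

section

variable {A Y Z : PSSet.{u}} (f : A ⟶ Y) (g : A ⟶ Z)

/-- The inclusion of `Y` in `Y ∪_A Z`. -/
def glue.inl : Y ⟶ glue f g :=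
  homMk (fun _ y => Quot.mk _ (.inl y)) (fun _ _ => rfl) (fun _ => rfl)

/-- The inclusion of `Z` in `Y ∪_A Z`. -/
def glue.inr : Z ⟶ glue f g :=
  homMk (fun _ z => Quot.mk _ (.inr z)) (fun _ _ => rfl) (fun k => by
    have := Quot.sound (GlueRel.glue (f := f) (g := g) (A.pt k))
    rw [Hom.ap, Hom.ap, Hom.app_pt, Hom.app_pt] at this
    exact this.symm)

variable {f g}

theorem glue.condition (k : SimplexCategoryᵒᵖ) (a : A.S k) :
    Hom.ap (glue.inl f g) k (Hom.ap f k a) = Hom.ap (glue.inr f g) k (Hom.ap g k a) :=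
  Quot.sound (.glue a)

/-- The map `Y ∪_A Z ⟶ T` determined by maps on `Y` and `Z` that agree on `A`. -/
def glue.desc {T : PSSet.{u}} (p : Y ⟶ T) (q : Z ⟶ T)
    (h : ∀ k a, Hom.ap p k (Hom.ap f k a) = Hom.ap q k (Hom.ap g k a)) : glue f g ⟶ T :=
  homMk (fun k => Quot.lift (Sum.elim (Hom.ap p k) (Hom.ap q k)) (by
      rintro _ _ ⟨a⟩
      exact h k a))
    (by
      rintro k l θ ⟨y | z⟩
      · exact NatTrans.naturality_apply (Hom.hom p) θ y
      · exact NatTrans.naturality_apply (Hom.hom q) θ z)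
    (fun k => Hom.app_pt p k)

end

/-- The pointed mapping space `Map_*(S¹, Y)`, as a subcomplex of the internal hom of simplicial
sets: a `k`-simplex is a map `S¹ × Δ[k] ⟶ Y` that is constant on `* × Δ[k]`. -/
def loops (Y : PSSet.{u}) : ((ihom circle.{u}.toSSet).obj Y.toSSet).Subcomplex where
  obj k := {a | ∀ (l : SimplexCategoryᵒᵖ) (θ : k ⟶ l), a.app l θ (circle.pt l) = Y.pt l}
  map := by
    intro k l θ a ha m η
    exact ha m (θ ≫ η)

end PSSet

/-! ### Symmetric spectra -/

/-- The iterate `Aₙ × T^p → Aₙ₊ₚ` of maps `Aₙ × T → Aₙ₊₁`. -/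
def iterSusp {A : ℕ → Type u} {T : Type u} (σ : ∀ n, A n → T → A (n + 1)) (n : ℕ) :
    ∀ p : ℕ, A n → (Fin p → T) → A (n + p)
  | 0, x, _ => x
  | p + 1, x, t => σ (n + p) (iterSusp σ n p x (fun i => t i.castSucc)) (t (Fin.last p))

/-- The block permutation `π × τ ∈ Σₙ × Σₚ ⊆ Σₙ₊ₚ`. -/
def blockPerm {n p : ℕ} (π : Equiv.Perm (Fin n)) (τ : Equiv.Perm (Fin p)) :
    Equiv.Perm (Fin (n + p)) :=
  finSumFinEquiv.permCongr (Equiv.Perm.sumCongr π τ)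

/-- A symmetric spectrum (of simplicial sets): a sequence of pointed simplicial sets `Xₙ` with a
left action of the symmetric group `Σₙ`, and pointed structure maps `Xₙ ∧ S¹ ⟶ Xₙ₊₁`, given here as
natural maps `Xₙ × S¹ → Xₙ₊₁` that collapse both axes, such that the iterated structure maps
`Xₙ ∧ (S¹)^{∧p} ⟶ Xₙ₊ₚ` are `Σₙ × Σₚ`-equivariant. -/
structure SymSpec where
  lvl : ℕ → PSSet.{u}
  act : ∀ n : ℕ, Equiv.Perm (Fin n) → (lvl n ⟶ lvl n)
  act_one : ∀ n k (x : (lvl n).S k), PSSet.Hom.ap (act n 1) k x = x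
  act_mul : ∀ n (π τ : Equiv.Perm (Fin n)) k (x : (lvl n).S k),
    PSSet.Hom.ap (act n (π * τ)) k x = PSSet.Hom.ap (act n π) k (PSSet.Hom.ap (act n τ) k x)
  susp : ∀ (k : SimplexCategoryᵒᵖ) (n : ℕ), (lvl n).S k → PSSet.circle.{u}.S k → (lvl (n + 1)).S k
  susp_pt_left : ∀ k n t, susp k n ((lvl n).pt k) t = (lvl (n + 1)).pt k
  susp_pt_right : ∀ k n x, susp k n x (PSSet.circle.pt k) = (lvl (n + 1)).pt k
  susp_nat : ∀ {k l : SimplexCategoryᵒᵖ} (θ : k ⟶ l) n x t,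
    susp l n ((lvl n).toSSet.map θ x) (PSSet.circle.toSSet.map θ t) =
      (lvl (n + 1)).toSSet.map θ (susp k n x t)
  susp_equivariant : ∀ k n p (π : Equiv.Perm (Fin n)) (τ : Equiv.Perm (Fin p)) (x : (lvl n).S k)
    (t : Fin p → PSSet.circle.S k),
    iterSusp (A := fun m => (lvl m).S k) (susp k) n p (PSSet.Hom.ap (act n π) k x)
        (fun i => t (τ⁻¹ i)) =
      PSSet.Hom.ap (act (n + p) (blockPerm π τ)) k
        (iterSusp (A := fun m => (lvl m).S k) (susp k) n p x t)

namespace SymSpec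

open PSSet

attribute [simp] act_one susp_pt_left susp_pt_right

/-- Morphisms of symmetric spectra: equivariant pointed maps `Xₙ ⟶ Yₙ` compatible with the
structure maps. -/
@[ext]
structure Hom (X Y : SymSpec.{u}) where
  lvl : ∀ n, X.lvl n ⟶ Y.lvl n
  lvl_act : ∀ n π k x, PSSet.Hom.ap (lvl n) k (PSSet.Hom.ap (X.act n π) k x) =
    PSSet.Hom.ap (Y.act n π) k (PSSet.Hom.ap (lvl n) k x)
  lvl_susp : ∀ k n x t, PSSet.Hom.ap (lvl (n + 1)) k (X.susp k n x t) =
    Y.susp k n (PSSet.Hom.ap (lvl n) k x) t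

instance : Category SymSpec.{u} where
  Hom X Y := Hom X Y
  id X := ⟨fun n => 𝟙 _, fun _ _ _ _ => rfl, fun _ _ _ _ => rfl⟩
  comp f g := ⟨fun n => f.lvl n ≫ g.lvl n,
    fun n π k x => (congrArg (PSSet.Hom.ap (g.lvl n) k) (f.lvl_act n π k x)).trans
      (g.lvl_act n π k _),
    fun k n x t => (congrArg (PSSet.Hom.ap (g.lvl (n + 1)) k) (f.lvl_susp k n x t)).trans
      (g.lvl_susp k n _ t)⟩

/-- The effect of a map of symmetric spectra on the `k`-simplices of level `n`. -/
abbrev ap {X Y : SymSpec.{u}} (f : X ⟶ Y) (n : ℕ) (k : SimplexCategoryᵒᵖ) (x : (X.lvl n).S k) :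
    (Y.lvl n).S k :=
  PSSet.Hom.ap (Hom.lvl f n) k x

/-- Maps that commute with the structure maps commute with their iterates. -/
theorem iterSusp_map {A B : ℕ → Type u} {T : Type u} {σ : ∀ n, A n → T → A (n + 1)}
    {τ : ∀ n, B n → T → B (n + 1)} (φ : ∀ n, A n → B n)
    (h : ∀ n x t, φ (n + 1) (σ n x t) = τ n (φ n x) t) (n p : ℕ) (x : A n) (t : Fin p → T) :
    φ (n + p) (iterSusp σ n p x t) = iterSusp τ n p (φ n x) t := by
  induction p with
  | zero => rfl
  | succ p ih => exact (h _ _ _).trans (congrArg (fun y => τ (n + p) y _) (ih _))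

/-- The symmetric spectrum `X ∧ K`, with levels `Xₙ ∧ K`. -/
def smash (X : SymSpec.{u}) (K : PSSet.{u}) : SymSpec.{u} where
  lvl n := PSSet.smash (X.lvl n) K
  act n π := PSSet.smash.map (X.act n π) K
  act_one := by
    rintro n k ⟨x, a⟩
    exact congrArg (fun y => smash.mk y a) (X.act_one n k x)
  act_mul := by
    rintro n π τ k ⟨x, a⟩
    exact congrArg (fun y => smash.mk y a) (X.act_mul n π τ k x)
  susp k n z t := PSSet.smash.lift (fun x a => smash.mk (X.susp k n x t) a)
    ((PSSet.smash (X.lvl (n + 1)) K).pt k) (by simp) (by simp) z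
  susp_pt_left k n t := congrArg (fun y => smash.mk y _) (X.susp_pt_left k n t) |>.trans (by simp)
  susp_pt_right := by
    rintro k n ⟨x, a⟩
    exact congrArg (fun y => smash.mk y a) (X.susp_pt_right k n x) |>.trans (by simp)
  susp_nat := by
    rintro k l θ n ⟨x, a⟩ t
    exact congrArg (fun y => smash.mk y _) (X.susp_nat θ n x t)
  susp_equivariant := by
    rintro k n p π τ ⟨x, a⟩ t
    refine (iterSusp_map (A := fun m => (X.lvl m).S k) (σ := X.susp k)
      (fun m (y : (X.lvl m).S k) => smash.mk y a) (fun _ _ _ => rfl) n p _ _).symm.trans ?_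
    refine (congrArg (fun y => smash.mk y a) (X.susp_equivariant k n p π τ x t)).trans ?_
    exact congrArg (PSSet.Hom.ap (PSSet.smash.map (X.act (n + p) (blockPerm π τ)) K) k)
      (iterSusp_map (A := fun m => (X.lvl m).S k) (σ := X.susp k)
        (fun m (y : (X.lvl m).S k) => smash.mk y a) (fun _ _ _ => rfl) n p x t)

/-- The map `f ∧ K`. -/
def smashMap {X Y : SymSpec.{u}} (f : X ⟶ Y) (K : PSSet.{u}) : X.smash K ⟶ Y.smash K where
  lvl n := PSSet.smash.map (Hom.lvl f n) K
  lvl_act := by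
    rintro n π k ⟨x, a⟩
    exact congrArg (fun y => smash.mk y a) (Hom.lvl_act f n π k x)
  lvl_susp := by
    rintro k n ⟨x, a⟩ t
    exact congrArg (fun y => smash.mk y a) (Hom.lvl_susp f k n x t)

/-- The inclusion `x ↦ x ∧ a` of `X` in `X ∧ K` at a vertex `a` of `K`, given as a compatible family
of (degenerate) simplices. -/
def inclAt (X : SymSpec.{u}) (K : PSSet.{u}) (a : ∀ k, K.S k)
    (ha : ∀ {k l : SimplexCategoryᵒᵖ} (θ : k ⟶ l), K.toSSet.map θ (a k) = a l) :
    X ⟶ X.smash K where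
  lvl _ := homMk (fun k x => smash.mk x (a k))
    (fun θ _ => congrArg (fun b => smash.mk _ b) (ha θ).symm) (fun _ => smash.mk_pt_left _)
  lvl_act _ _ _ _ := rfl
  lvl_susp _ _ _ _ := rfl

/-- The action of the symmetric groups on the pushout of symmetric spectra. -/
def glueAct {A Y Z : SymSpec.{u}} (f : A ⟶ Y) (g : A ⟶ Z) (n : ℕ) (π : Equiv.Perm (Fin n)) :
    PSSet.glue (Hom.lvl f n) (Hom.lvl g n) ⟶ PSSet.glue (Hom.lvl f n) (Hom.lvl g n) :=
  PSSet.glue.desc (Y.act n π ≫ PSSet.glue.inl _ _) (Z.act n π ≫ PSSet.glue.inr _ _) (by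
    intro k a
    refine (congrArg (PSSet.Hom.ap (PSSet.glue.inl _ _) k) (Hom.lvl_act f n π k a)).symm.trans ?_
    refine (PSSet.glue.condition k _).trans ?_
    exact congrArg (PSSet.Hom.ap (PSSet.glue.inr _ _) k) (Hom.lvl_act g n π k a))

/-- The structure maps of the pushout of symmetric spectra. -/
def glueSusp {A Y Z : SymSpec.{u}} (f : A ⟶ Y) (g : A ⟶ Z) (k : SimplexCategoryᵒᵖ) (n : ℕ)
    (w : (PSSet.glue (Hom.lvl f n) (Hom.lvl g n)).S k) (t : circle.{u}.S k) :
    (PSSet.glue (Hom.lvl f (n + 1)) (Hom.lvl g (n + 1))).S k :=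
  Quot.lift
    (Sum.elim (fun y => PSSet.Hom.ap (PSSet.glue.inl (Hom.lvl f (n + 1)) (Hom.lvl g (n + 1))) k
        (Y.susp k n y t))
      (fun z => PSSet.Hom.ap (PSSet.glue.inr (Hom.lvl f (n + 1)) (Hom.lvl g (n + 1))) k
        (Z.susp k n z t))) (by
      rintro _ _ ⟨a⟩
      refine (congrArg (PSSet.Hom.ap (PSSet.glue.inl _ _) k)
        (Hom.lvl_susp f k n a t)).symm.trans ?_
      refine (PSSet.glue.condition k _).trans ?_
      exact congrArg (PSSet.Hom.ap (PSSet.glue.inr _ _) k) (Hom.lvl_susp g k n a t)) w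

/-- The pushout `Y ∪_A Z` of symmetric spectra, formed levelwise. -/
def glue {A Y Z : SymSpec.{u}} (f : A ⟶ Y) (g : A ⟶ Z) : SymSpec.{u} where
  lvl n := PSSet.glue (Hom.lvl f n) (Hom.lvl g n)
  act := glueAct f g
  act_one := by
    rintro n k ⟨y | z⟩
    · exact congrArg (PSSet.Hom.ap (PSSet.glue.inl _ _) k) (Y.act_one n k y)
    · exact congrArg (PSSet.Hom.ap (PSSet.glue.inr _ _) k) (Z.act_one n k z)
  act_mul := by
    rintro n π τ k ⟨y | z⟩
    · exact congrArg (PSSet.Hom.ap (PSSet.glue.inl _ _) k) (Y.act_mul n π τ k y)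
    · exact congrArg (PSSet.Hom.ap (PSSet.glue.inr _ _) k) (Z.act_mul n π τ k z)
  susp := glueSusp f g
  susp_pt_left k n t := congrArg (PSSet.Hom.ap (PSSet.glue.inl _ _) k) (Y.susp_pt_left k n t)
  susp_pt_right := by
    rintro k n ⟨y | z⟩
    · exact congrArg (PSSet.Hom.ap (PSSet.glue.inl _ _) k) (Y.susp_pt_right k n y)
    · exact (congrArg (PSSet.Hom.ap (PSSet.glue.inr _ _) k) (Z.susp_pt_right k n z)).trans
        (PSSet.Hom.app_pt _ k)
  susp_nat := by
    rintro k l θ n ⟨y | z⟩ t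
    · exact congrArg (PSSet.Hom.ap (PSSet.glue.inl _ _) l) (Y.susp_nat θ n y t)
    · exact congrArg (PSSet.Hom.ap (PSSet.glue.inr _ _) l) (Z.susp_nat θ n z t)
  susp_equivariant := by
    rintro k n p π τ ⟨y | z⟩ t
    · refine (iterSusp_map (A := fun m => (Y.lvl m).S k) (σ := Y.susp k)
        (τ := glueSusp f g k) (fun m => PSSet.Hom.ap (PSSet.glue.inl (Hom.lvl f m) (Hom.lvl g m)) k)
        (fun _ _ _ => rfl) n p _ _).symm.trans ?_
      refine (congrArg (PSSet.Hom.ap (PSSet.glue.inl _ _) k)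
        (Y.susp_equivariant k n p π τ y t)).trans ?_
      exact congrArg (PSSet.Hom.ap (glueAct f g (n + p) (blockPerm π τ)) k)
        (iterSusp_map (A := fun m => (Y.lvl m).S k)
        (σ := Y.susp k) (τ := glueSusp f g k)
        (fun m => PSSet.Hom.ap (PSSet.glue.inl (Hom.lvl f m) (Hom.lvl g m)) k)
        (fun _ _ _ => rfl) n p y t)
    · refine (iterSusp_map (A := fun m => (Z.lvl m).S k) (σ := Z.susp k)
        (τ := glueSusp f g k) (fun m => PSSet.Hom.ap (PSSet.glue.inr (Hom.lvl f m) (Hom.lvl g m)) k)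
        (fun _ _ _ => rfl) n p _ _).symm.trans ?_
      refine (congrArg (PSSet.Hom.ap (PSSet.glue.inr _ _) k)
        (Z.susp_equivariant k n p π τ z t)).trans ?_
      exact congrArg (PSSet.Hom.ap (glueAct f g (n + p) (blockPerm π τ)) k)
        (iterSusp_map (A := fun m => (Z.lvl m).S k)
        (σ := Z.susp k) (τ := glueSusp f g k)
        (fun m => PSSet.Hom.ap (PSSet.glue.inr (Hom.lvl f m) (Hom.lvl g m)) k)
        (fun _ _ _ => rfl) n p z t)

section

variable {A Y Z : SymSpec.{u}} (f : A ⟶ Y) (g : A ⟶ Z)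

/-- The inclusion of `Y` in `Y ∪_A Z`. -/
def glue.inl : Y ⟶ glue f g where
  lvl _ := PSSet.glue.inl _ _
  lvl_act _ _ _ _ := rfl
  lvl_susp _ _ _ _ := rfl

/-- The inclusion of `Z` in `Y ∪_A Z`. -/
def glue.inr : Z ⟶ glue f g where
  lvl _ := PSSet.glue.inr _ _
  lvl_act _ _ _ _ := rfl
  lvl_susp _ _ _ _ := rfl

theorem glue.condition : f ≫ glue.inl f g = g ≫ glue.inr f g := by
  refine Hom.ext (funext fun n => PSSet.Hom.ext (NatTrans.ext (funext fun k => ?_)))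
  ext a
  exact PSSet.glue.condition k a

variable {f g}

/-- The map `Y ∪_A Z ⟶ T` determined by maps on `Y` and `Z` that agree on `A`. -/
def glue.desc {T : SymSpec.{u}} (p : Y ⟶ T) (q : Z ⟶ T) (h : f ≫ p = g ≫ q) :
    glue f g ⟶ T where
  lvl n := PSSet.glue.desc (Hom.lvl p n) (Hom.lvl q n)
    (fun k a => congrArg (fun r => ap r n k a) h)
  lvl_act := by
    rintro n π k ⟨y | z⟩
    · exact Hom.lvl_act p n π k y
    · exact Hom.lvl_act q n π k z
  lvl_susp := by
    rintro k n ⟨y | z⟩ t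
    · exact Hom.lvl_susp p k n y t
    · exact Hom.lvl_susp q k n z t

end

/-- The trivial symmetric spectrum `*`. -/
def point : SymSpec.{u} where
  lvl _ := ⟨𝟙_ _, fun _ => PUnit.unit, fun _ => rfl⟩
  act _ _ := 𝟙 _
  act_one _ _ _ := rfl
  act_mul _ _ _ _ _ := rfl
  susp _ _ _ _ := PUnit.unit
  susp_pt_left _ _ _ := rfl
  susp_pt_right _ _ _ := rfl
  susp_nat _ _ _ _ := rfl
  susp_equivariant _ _ _ _ _ _ _ := rfl

/-- The unique map `* ⟶ X`. -/
def fromPoint (X : SymSpec.{u}) : point ⟶ X where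
  lvl n := homMk (fun k _ => (X.lvl n).pt k) (fun _ _ => by simp) (fun _ => rfl)
  lvl_act n π k _ := (PSSet.Hom.app_pt (X.act n π) k).symm
  lvl_susp k n _ t := (X.susp_pt_left k n t).symm

/-- The wedge `X ∨ Y`. -/
abbrev wedge (X Y : SymSpec.{u}) : SymSpec.{u} := glue (fromPoint X) (fromPoint Y)

/-- The map `f ∨ g : X ∨ Y ⟶ T` which is `f` on `X` and `g` on `Y`. -/
def wedgeDesc {X Y T : SymSpec.{u}} (f : X ⟶ T) (g : Y ⟶ T) : wedge X Y ⟶ T :=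
  glue.desc f g (by
    refine Hom.ext (funext fun n => PSSet.Hom.ext (NatTrans.ext (funext fun k => ?_)))
    ext a
    exact (PSSet.Hom.app_pt (Hom.lvl f n) k).trans (PSSet.Hom.app_pt (Hom.lvl g n) k).symm)

/-- The suspension `ΣX = X ∧ S¹`. -/
abbrev suspension (X : SymSpec.{u}) : SymSpec.{u} := X.smash circle

/-- The inclusion of `X` in the base of its cone `X ∧ Δ[1]`, where `Δ[1]` is based at `1`. -/
def coneIncl (X : SymSpec.{u}) : X ⟶ X.smash interval :=
  X.inclAt interval (fun k => SSet.stdSimplex.const 1 0 k) (map_const 0)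

/-- The homotopy cofiber (mapping cone) `Y ∪_X (X ∧ Δ[1])` of `f : X ⟶ Y`. -/
abbrev cofiber {X Y : SymSpec.{u}} (f : X ⟶ Y) : SymSpec.{u} := glue f (coneIncl X)

/-- The map of homotopy cofibers induced by a commutative square. -/
def cofiberMap {X Y X' Y' : SymSpec.{u}} (f : X ⟶ Y) (f' : X' ⟶ Y') (a : X ⟶ X') (b : Y ⟶ Y')
    (h : f ≫ b = a ≫ f') : cofiber f ⟶ cofiber f' :=
  glue.desc (b ≫ glue.inl f' (coneIncl X')) (smashMap a interval ≫ glue.inr f' (coneIncl X')) (by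
    rw [← Category.assoc, h, Category.assoc, glue.condition]
    rfl)

/-- The `2`-cofiber (total cofiber) of a commutative square of symmetric spectra with
`α : M₀₀ ⟶ M₀₁`, `β : M₀₀ ⟶ M₁₀`, `γ : M₁₀ ⟶ M₁₁` and `δ : M₀₁ ⟶ M₁₁`: the homotopy cofiber of the map
from the homotopy cofiber of `β` to the homotopy cofiber of `δ` that is induced by `α` and `γ`. -/
def cofiber₂ {M₀₀ M₀₁ M₁₀ M₁₁ : SymSpec.{u}} (α : M₀₀ ⟶ M₀₁) (β : M₀₀ ⟶ M₁₀) (γ : M₁₀ ⟶ M₁₁)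
    (δ : M₀₁ ⟶ M₁₁) (h : β ≫ γ = α ≫ δ) : SymSpec.{u} :=
  cofiber (cofiberMap β δ α γ h)

/-! ### Stable equivalences -/

/-- A map is a level equivalence if each `Xₙ ⟶ Yₙ` is a weak equivalence of simplicial sets. -/
def IsLevelEquiv {X Y : SymSpec.{u}} (f : X ⟶ Y) : Prop :=
  ∀ n, SSet.IsWeakEquiv (PSSet.Hom.hom (Hom.lvl f n))

/-- `E` is injective if it has the extension property with respect to every monomorphism (levelwise
injection) of symmetric spectra that is a level equivalence. -/
def IsInjective (E : SymSpec.{u}) : Prop :=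
  ∀ (A B : SymSpec.{u}) (i : A ⟶ B), (∀ n k, Function.Injective (ap i n k)) → IsLevelEquiv i →
    ∀ f : A ⟶ E, ∃ g : B ⟶ E, i ≫ g = f

/-- The adjoint `Eₙ ⟶ Map_*(S¹, Eₙ₊₁)` of the structure map. -/
def adjSusp (E : SymSpec.{u}) (n : ℕ) : (E.lvl n).toSSet ⟶ (loops (E.lvl (n + 1))).toSSet where
  app k := ↾fun x => ⟨{ app := fun l θ => ↾fun t => E.susp l n ((E.lvl n).toSSet.map θ x) t
                        naturality := fun {l m} η θ => by
                          ext t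
                          have := E.susp_nat η n ((E.lvl n).toSSet.map θ x) t
                          rw [← Functor.map_comp_apply] at this
                          exact this },
    fun l _ => E.susp_pt_right l n _⟩
  naturality k l θ := by
    ext x
    refine Subtype.ext (Functor.HomObj.ext (funext fun m => funext fun η => ?_))
    ext t
    exact congrArg (fun y => E.susp m n y t)
      (Functor.map_comp_apply (E.lvl n).toSSet θ η x).symm

/-- `E` is an `Ω`-spectrum if each `Eₙ` is a Kan complex and each `Eₙ ⟶ Map_*(S¹, Eₙ₊₁)` is a weak
equivalence. -/
def IsOmega (E : SymSpec.{u}) : Prop :=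
  ∀ n, SSet.KanComplex (E.lvl n).toSSet ∧ SSet.IsWeakEquiv (E.adjSusp n)

/-- The inclusion of `X` in `X ∧ Δ[1]₊` at the vertex `i`. -/
def cylIncl (X : SymSpec.{u}) (i : Fin 2) : X ⟶ X.smash (plus SSet.Δ1) :=
  X.inclAt (plus SSet.Δ1) (fun k => some (SSet.stdSimplex.const 1 i k)) (fun _ => rfl)

/-- `f` and `g` are related by a homotopy `X ∧ Δ[1]₊ ⟶ E`. -/
def HomotopyRel {X E : SymSpec.{u}} (f g : X ⟶ E) : Prop :=
  ∃ H : X.smash (plus SSet.Δ1) ⟶ E, X.cylIncl 0 ≫ H = f ∧ X.cylIncl 1 ≫ H = g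

/-- `E⁰(X) = π₀ Map(X, E)`: maps modulo the equivalence relation generated by homotopies. -/
def E0 (E X : SymSpec.{u}) : Type u := Quot (HomotopyRel (X := X) (E := E))

/-- The map `E⁰(Y) → E⁰(X)` induced by `f : X ⟶ Y`. -/
def E0.map (E : SymSpec.{u}) {X Y : SymSpec.{u}} (f : X ⟶ Y) : E0 E Y → E0 E X :=
  Quot.lift (fun g => Quot.mk _ (f ≫ g)) (by
    rintro g g' ⟨H, rfl, rfl⟩
    exact Quot.sound ⟨smashMap f (plus SSet.Δ1) ≫ H, rfl, rfl⟩)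

/-- A map `f : X ⟶ Y` of symmetric spectra is an equivalence (stable equivalence) if
`E⁰(Y) → E⁰(X)` is a bijection for every injective `Ω`-spectrum `E`. -/
def IsStableEquiv {X Y : SymSpec.{u}} (f : X ⟶ Y) : Prop :=
  ∀ E : SymSpec.{u}, IsInjective E → IsOmega E → Function.Bijective (E0.map E f)

/-- `X ≃ Y`: the symmetric spectra `X` and `Y` are connected by a zigzag of stable equivalences. -/
def Equivalent (X Y : SymSpec.{u}) : Prop :=
  Relation.EqvGen (fun X Y : SymSpec.{u} => ∃ f : X ⟶ Y, IsStableEquiv f) X Y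

end SymSpec

end

universe v w

noncomputable section

/-! ### Lifting against pushout-products -/

namespace SSet

open Simplicial HomotopicalAlgebra Limits CartesianMonoidalCategory modelCategoryQuillen

/-! Write C(f) for the homotopy cofiber of f and CX for the cone on X. Since M₁₀ splits as M₀₀ ∨ M₁₁
up to equivalence, with β as the first inclusion, C(β) is equivalent to M₁₁: the composite j : M₁₁ →
M₁₀ → C(β) of s and the inclusion is a stable equivalence (`isStableEquiv_comp_inl_cofiber`).
Because γ s = Id, following j by the induced map c : C(β) → C(δ) gives the inclusion M₁₁ → C(δ).
Hence the total cofiber C(c) is equivalent to the cofiber of M₁₁ → C(δ)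
(`exists_isStableEquiv_cofiber₂`). That cofiber is CM₀₁ and CM₁₁ glued along M₀₁, and collapsing the
contractible CM₁₁ leaves ΣM₀₁ (`exists_isStableEquiv_suspension`).

These comparison maps are built from cobase changes, so what is needed is that stable equivalences
compose, satisfy a cancellation law, and are stable under cobase change when they are levelwise
injective or when the change is along a levelwise injection. Their definition only tests E⁰, which
is too weak to see this directly. The remedy is to pass to mapping spaces: homotopy classes of maps
L → Map(X, E) are (E ^ L)⁰(X), and E ^ L is again an injective Ω-spectrum. So f is a stable
equivalence exactly when Map(f, E) is a weak equivalence for every injective Ω-spectrum E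
(`IsStableEquiv.isWeakEquiv_mapSpacePre`, `isStableEquiv_of_isWeakEquiv_mapSpacePre`). Now Map(-, E)
has Kan complexes as values, takes pushouts to pullbacks and levelwise injections to Kan fibrations.
The two cobase change statements become base change of trivial fibrations and right properness for
Kan complexes (`isWeakEquiv_of_isPullback`).

Weak equivalences of simplicial sets are likewise defined by mapping into Kan complexes. The
homotopy theory required is derived from the fact that the pushout-product of a monomorphism and an
anodyne extension is anodyne. The central result is `rlp_monomorphisms_of_fibration`. It yields
`IsWeakEquiv.exists_extension`, hence that smashing with L₊ preserves injective level equivalences,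
hence that E ^ L is injective. -/

/-- A map of simplicial sets from its values on simplices. -/
def ofFun {X Y : SSet.{u}} (f : ∀ k, X.obj k → Y.obj k)
    (hf : ∀ {k l : SimplexCategoryᵒᵖ} (θ : k ⟶ l) (x : X.obj k),
      f l (X.map θ x) = Y.map θ (f k x)) : X ⟶ Y where
  app k := ↾(f k)
  naturality k l θ := by
    ext x
    exact hf θ x

theorem hom_ext_apply {X Y : SSet.{u}} {f g : X ⟶ Y} (h : ∀ k x, f.app k x = g.app k x) :
    f = g := by
  refine NatTrans.ext (funext fun k => ?_)
  ext x
  exact h k x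

theorem congr_apply {X Y : SSet.{u}} {f g : X ⟶ Y} (h : f = g) (k : SimplexCategoryᵒᵖ)
    (x : X.obj k) : f.app k x = g.app k x := by
  rw [h]

theorem mono_of_injective {X Y : SSet.{u}} (f : X ⟶ Y)
    (hf : ∀ k, Function.Injective (f.app k)) : Mono f := by
  have : ∀ k, Mono (f.app k) := fun k => (CategoryTheory.mono_iff_injective _).2 (hf k)
  exact NatTrans.mono_of_mono_app f

theorem injective_of_mono {X Y : SSet.{u}} (f : X ⟶ Y) [Mono f] (k : SimplexCategoryᵒᵖ) :
    Function.Injective (f.app k) :=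
  (CategoryTheory.mono_iff_injective _).1 inferInstance

/-- Lifting against the pushout-product of a monomorphism and an anodyne extension. -/
theorem exists_lift_pushoutProduct {A B K L S T : SSet.{u}} (i : A ⟶ B) [Mono i] {j : K ⟶ L}
    (hj : anodyneExtensions j) (p : S ⟶ T) [Fibration p] (a : A ⊗ L ⟶ S) (b : B ⊗ K ⟶ S)
    (w : B ⊗ L ⟶ T) (hab : A ◁ j ≫ a = i ▷ K ≫ b) (ha : a ≫ p = i ▷ L ≫ w)
    (hb : b ≫ p = B ◁ j ≫ w) :
    ∃ χ : B ⊗ L ⟶ S, i ▷ L ≫ χ = a ∧ B ◁ j ≫ χ = b ∧ χ ≫ p = w := by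
  let sq := Functor.PushoutObjObj.ofHasPushout (curriedTensor SSet.{u}) i j
  have hsq := anodyneExtensions_pushoutObjObjι sq hj
  have := hsq p (mem_fibrations p)
  have hc : CommSq (sq.isPushout.desc b a hab.symm) sq.ι p w := by
    refine ⟨sq.isPushout.hom_ext ?_ ?_⟩
    · rw [sq.isPushout.inl_desc_assoc, sq.inl_ι_assoc, hb]; rfl
    · rw [sq.isPushout.inr_desc_assoc, sq.inr_ι_assoc, ha]; rfl
  refine ⟨hc.lift, ?_, ?_, hc.fac_right⟩
  · have := congrArg (sq.inr ≫ ·) hc.fac_left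
    simp only [sq.isPushout.inr_desc, sq.inr_ι_assoc] at this
    exact this
  · have := congrArg (sq.inl ≫ ·) hc.fac_left
    simp only [sq.isPushout.inl_desc, sq.inl_ι_assoc] at this
    exact this

theorem fibration_terminal (Z : SSet.{u}) [KanComplex Z] : Fibration (terminal.from Z) :=
  (isFibrant_iff Z).1 inferInstance

/-- Extension of maps to a Kan complex along the pushout-product of a monomorphism and an anodyne
extension. -/
theorem exists_extension_pushoutProduct {A B K L Z : SSet.{u}} [KanComplex Z] (i : A ⟶ B) [Mono i]
    {j : K ⟶ L} (hj : anodyneExtensions j) (a : A ⊗ L ⟶ Z) (b : B ⊗ K ⟶ Z)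
    (hab : A ◁ j ≫ a = i ▷ K ≫ b) :
    ∃ χ : B ⊗ L ⟶ Z, i ▷ L ≫ χ = a ∧ B ◁ j ≫ χ = b := by
  have := fibration_terminal Z
  obtain ⟨χ, h₁, h₂, -⟩ := exists_lift_pushoutProduct i hj (terminal.from Z) a b
    (terminal.from _) hab (by subsingleton) (by subsingleton)
  exact ⟨χ, h₁, h₂⟩

theorem kanComplex_of_exists_extension {Z : SSet.{u}}
    (h : ∀ (n : ℕ) (i : Fin (n + 2)) (σ : (Λ[n + 1, i] : SSet.{u}) ⟶ Z),
      ∃ τ : Δ[n + 1] ⟶ Z, Λ[n + 1, i].ι ≫ τ = σ) : KanComplex Z := by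
  refine (isFibrant_iff Z).2 ((modelCategoryQuillen.fibration_iff _).2 ?_)
  intro _ _ _ hf
  simp only [modelCategoryQuillen.J, MorphismProperty.iSup_iff] at hf
  obtain ⟨n, ⟨i⟩⟩ := hf
  refine ⟨fun {t _} _ => ?_⟩
  obtain ⟨τ, hτ⟩ := h n i t
  exact ⟨⟨{ l := τ, fac_left := hτ, fac_right := by subsingleton }⟩⟩

theorem fibration_of_exists_lift {X Y : SSet.{u}} (p : X ⟶ Y)
    (h : ∀ (n : ℕ) (i : Fin (n + 2)) (σ : (Λ[n + 1, i] : SSet.{u}) ⟶ X) (τ : Δ[n + 1] ⟶ Y),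
      σ ≫ p = Λ[n + 1, i].ι ≫ τ → ∃ χ : Δ[n + 1] ⟶ X, Λ[n + 1, i].ι ≫ χ = σ ∧ χ ≫ p = τ) :
    Fibration p := by
  refine (modelCategoryQuillen.fibration_iff _).2 ?_
  intro _ _ _ hf
  simp only [modelCategoryQuillen.J, MorphismProperty.iSup_iff] at hf
  obtain ⟨n, ⟨i⟩⟩ := hf
  refine ⟨fun {s t} sq => ?_⟩
  obtain ⟨χ, h₁, h₂⟩ := h n i s t sq.w
  exact ⟨⟨{ l := χ, fac_left := h₁, fac_right := h₂ }⟩⟩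

/-! ### Homotopies -/

/-- The inclusion `X ⟶ X × Δ[1]` at the vertex `ε`. -/
def incl (ε : Fin 2) (X : SSet.{u}) : X ⟶ X ⊗ Δ[1] :=
  ofFun (fun k x => (x, stdSimplex.const 1 ε k)) (fun _ _ => rfl)

/-- The horn Λ[1, ε] is the single vertex ε. Lifting against the pushout-product with its inclusion
is therefore homotopy lifting from the end ε. -/
theorem eq_const_of_mem_horn {k : SimplexCategoryᵒᵖ} {ε : Fin 2} {s : (Δ[1] : SSet.{u}).obj k}
    (hs : s ∈ (horn.{u} 1 ε).obj k) : s = stdSimplex.const 1 ε k := by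
  rw [mem_horn_iff, Ne, Set.eq_univ_iff_forall, not_forall] at hs
  obtain ⟨j, hj⟩ := hs
  rw [Set.mem_union, not_or] at hj
  refine stdSimplex.objEquiv.injective (SimplexCategory.Hom.ext _ _ (OrderHom.ext _ _ (funext
    fun m => ?_)))
  have h₁ : stdSimplex.asOrderHom s m ≠ j := fun h => hj.1 ⟨m, h⟩
  have h₂ : ε ≠ j := fun h => hj.2 h.symm
  change stdSimplex.asOrderHom s m = ε
  omega

theorem const_mem_horn (ε : Fin 2) (k : SimplexCategoryᵒᵖ) :
    stdSimplex.const 1 ε k ∈ (horn.{u} 1 ε).obj k := by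
  rw [mem_horn_iff, Ne, Set.eq_univ_iff_forall, not_forall]
  -- In `Fin 2`, `1 - ε` is the other vertex, the one that a simplex constant at ε misses.
  refine ⟨1 - ε, ?_⟩
  rintro (⟨m, hm⟩ | h)
  · change ε = 1 - ε at hm
    omega
  · change 1 - ε = ε at h
    omega

theorem mem_boundary_one {k : SimplexCategoryᵒᵖ} {s : (Δ[1] : SSet.{u}).obj k} :
    s ∈ (boundary.{u} 1).obj k ↔ ∃ ε, s = stdSimplex.const 1 ε k := by
  constructor
  · intro hs
    change ¬ Function.Surjective (stdSimplex.asOrderHom s) at hs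
    rw [Function.Surjective, not_forall] at hs
    obtain ⟨j, hj⟩ := hs
    refine ⟨1 - j, eq_const_of_mem_horn ?_⟩
    rw [mem_horn_iff, Ne, Set.eq_univ_iff_forall, not_forall]
    refine ⟨j, ?_⟩
    rintro (⟨m, hm⟩ | h)
    · exact hj ⟨m, hm⟩
    · exact absurd (show j = 1 - j from h) (by clear hj h; revert j; decide)
  · rintro ⟨ε, rfl⟩ h
    obtain ⟨m, hm⟩ := h (1 - ε)
    exact absurd (show ε = 1 - ε from hm) (by clear hm h; revert ε; decide)

theorem const_inj {k : SimplexCategoryᵒᵖ} {ε ε' : Fin 2}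
    (h : stdSimplex.const.{u} 1 ε k = stdSimplex.const 1 ε' k) : ε = ε' :=
  congrArg (fun s => stdSimplex.asOrderHom s 0) h

/-- The homotopy extension and lifting property. -/
theorem exists_homotopy_lift (ε : Fin 2) {K L X Y : SSet.{u}} (i : K ⟶ L) [Mono i] (p : X ⟶ Y)
    [Fibration p] (f : L ⟶ X) (H : K ⊗ Δ[1] ⟶ X) (h : L ⊗ Δ[1] ⟶ Y)
    (hf : incl ε K ≫ H = i ≫ f) (hp : H ≫ p = i ▷ _ ≫ h) (hfp : incl ε L ≫ h = f ≫ p) :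
    ∃ H' : L ⊗ Δ[1] ⟶ X, i ▷ _ ≫ H' = H ∧ incl ε L ≫ H' = f ∧ H' ≫ p = h := by
  have h₁ : K ◁ (horn.{u} 1 ε).ι ≫ H = i ▷ _ ≫ fst L _ ≫ f := by
    refine hom_ext_apply fun k => ?_
    rintro ⟨x, ⟨s, hs⟩⟩
    obtain rfl := eq_const_of_mem_horn hs
    exact congr_apply hf k x
  have h₂ : (fst L _ ≫ f) ≫ p = L ◁ (horn.{u} 1 ε).ι ≫ h := by
    refine hom_ext_apply fun k => ?_
    rintro ⟨x, ⟨s, hs⟩⟩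
    obtain rfl := eq_const_of_mem_horn hs
    exact (congr_apply hfp k x).symm
  obtain ⟨χ, h₃, h₄, h₅⟩ := exists_lift_pushoutProduct i (anodyneExtensions.horn_ι ε) p H _ h h₁
    hp h₂
  refine ⟨χ, h₃, hom_ext_apply fun k x => ?_, h₅⟩
  exact congr_apply h₄ k (x, ⟨_, const_mem_horn ε k⟩)

/-- The map on `L × ∂Δ[1]` given by two maps on `L`. -/
def boundaryDesc {L X : SSet.{u}} (f : Fin 2 → (L ⟶ X)) :
    L ⊗ (boundary.{u} 1 : SSet.{u}) ⟶ X :=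
  -- A simplex of ∂Δ[1] is constant, so its value at 0 names the vertex at which it sits.
  ofFun (fun k x => (f (stdSimplex.asOrderHom x.2.1 0)).app k x.1) (by
    rintro k l θ ⟨x, ⟨s, hs⟩⟩
    obtain ⟨ε, rfl⟩ := mem_boundary_one.1 hs
    exact NatTrans.naturality_apply (f ε) θ x)

theorem whiskerLeft_boundary_comp_eq_iff {L X : SSet.{u}} (f : Fin 2 → (L ⟶ X))
    (H : L ⊗ Δ[1] ⟶ X) :
    L ◁ (boundary.{u} 1).ι ≫ H = boundaryDesc f ↔ ∀ ε, incl ε L ≫ H = f ε := by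
  constructor
  · intro h ε
    exact hom_ext_apply fun k x =>
      congr_apply h k (x, ⟨stdSimplex.const 1 ε k, mem_boundary_one.2 ⟨ε, rfl⟩⟩)
  · intro h
    refine hom_ext_apply fun k => ?_
    rintro ⟨x, ⟨s, hs⟩⟩
    obtain ⟨ε, rfl⟩ := mem_boundary_one.1 hs
    exact congr_apply (h ε) k x

/-- Two maps are related by a homotopy. -/
def Homotopic {X Y : SSet.{u}} (f g : X ⟶ Y) : Prop :=
  ∃ H : X ⊗ Δ[1] ⟶ Y, incl 0 X ≫ H = f ∧ incl 1 X ≫ H = g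

theorem nonempty_homotopy_iff {X Y : SSet.{u}} {f g : X ⟶ Y} :
    Nonempty (Homotopy f g) ↔ Homotopic f g := by
  constructor
  · rintro ⟨H⟩
    exact ⟨H.h, H.h₀, H.h₁⟩
  · rintro ⟨H, h₀, h₁⟩
    exact ⟨{ h := H
             h₀ := h₀
             h₁ := h₁
             rel := by
               ext _ ⟨⟨_, hx⟩, _⟩
               exact hx.elim }⟩

theorem Homotopic.refl {X Y : SSet.{u}} (f : X ⟶ Y) : Homotopic f f :=
  ⟨fst _ _ ≫ f, rfl, rfl⟩

theorem Homotopic.comp_right {X Y Z : SSet.{u}} {f g : X ⟶ Y} (h : Homotopic f g) (p : Y ⟶ Z) :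
    Homotopic (f ≫ p) (g ≫ p) := by
  obtain ⟨H, rfl, rfl⟩ := h
  exact ⟨H ≫ p, rfl, rfl⟩

theorem Homotopic.comp_left {X Y Z : SSet.{u}} {f g : X ⟶ Y} (h : Homotopic f g) (e : Z ⟶ X) :
    Homotopic (e ≫ f) (e ≫ g) := by
  obtain ⟨H, rfl, rfl⟩ := h
  exact ⟨e ▷ _ ≫ H, rfl, rfl⟩

/-- Filling a square with three given sides. -/
theorem exists_square (ε : Fin 2) {L X Y : SSet.{u}} (p : X ⟶ Y) [Fibration p]
    (H : Fin 2 → (L ⊗ Δ[1] ⟶ X)) (f : L ⊗ Δ[1] ⟶ X) (h : (L ⊗ Δ[1]) ⊗ Δ[1] ⟶ Y)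
    (hf : ∀ η, incl ε L ≫ H η = incl η L ≫ f) (hp : ∀ η, H η ≫ p = incl η L ▷ _ ≫ h)
    (hfp : incl ε _ ≫ h = f ≫ p) :
    ∃ S : (L ⊗ Δ[1]) ⊗ Δ[1] ⟶ X, (∀ η, incl η L ▷ _ ≫ S = H η) ∧ incl ε _ ≫ S = f ∧
      S ≫ p = h := by
  -- The two opposite sides form one homotopy on L × ∂Δ[1]; the square is its extension to L × Δ[1]
  -- with the prescribed end `f`.
  let G : (L ⊗ (boundary.{u} 1 : SSet.{u})) ⊗ Δ[1] ⟶ X :=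
    ofFun (fun k x => (H (stdSimplex.asOrderHom x.1.2.1 0)).app k (x.1.1, x.2)) (by
      rintro k l θ ⟨⟨x, ⟨s, hs⟩⟩, t⟩
      obtain ⟨η, rfl⟩ := mem_boundary_one.1 hs
      exact NatTrans.naturality_apply (H η) θ ((x, t) : (L ⊗ Δ[1]).obj k))
  have : Mono (L ◁ (boundary.{u} 1).ι) := mono_of_injective _ fun k => by
    rintro ⟨x, s⟩ ⟨y, t⟩ h
    have h' : (x, s.1) = (y, t.1) := h
    exact Prod.ext (Prod.mk.inj h').1 (Subtype.ext (Prod.mk.inj h').2)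
  have hG : incl ε _ ≫ G = L ◁ (boundary.{u} 1).ι ≫ f := by
    refine hom_ext_apply ?_
    rintro k ⟨x, ⟨s, hs⟩⟩
    obtain ⟨η, rfl⟩ := mem_boundary_one.1 hs
    exact congr_apply (hf η) k x
  have hGp : G ≫ p = (L ◁ (boundary.{u} 1).ι) ▷ _ ≫ h := by
    refine hom_ext_apply ?_
    rintro k ⟨⟨x, ⟨s, hs⟩⟩, t⟩
    obtain ⟨η, rfl⟩ := mem_boundary_one.1 hs
    exact congr_apply (hp η) k (x, t)
  obtain ⟨S, h₁, h₂, h₃⟩ := exists_homotopy_lift ε (L ◁ (boundary.{u} 1).ι) p f G h hG hGp hfp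
  refine ⟨S, fun η => hom_ext_apply ?_, h₂, h₃⟩
  rintro k ⟨x, t⟩
  exact congr_apply h₁ k ((x, ⟨stdSimplex.const 1 η k, mem_boundary_one.2 ⟨η, rfl⟩⟩), t)

/-- Fill a square with parallel sides `H` and `H'` and a constant third side; the remaining side
joins `g` to `h`. Symmetry and transitivity both follow from this. -/
theorem Homotopic.euclidean {X Z : SSet.{u}} [KanComplex Z] {f g h : X ⟶ Z}
    (h₁ : Homotopic f g) (h₂ : Homotopic f h) : Homotopic g h := by
  obtain ⟨H, rfl, rfl⟩ := h₁
  obtain ⟨H', h', rfl⟩ := h₂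
  have := fibration_terminal Z
  obtain ⟨S, hS, -⟩ := exists_square 0 (terminal.from Z) ![H, H'] (fst _ _ ≫ incl 0 X ≫ H)
    (terminal.from _) (fun η => by fin_cases η; exacts [rfl, h']) (fun _ => by subsingleton)
    (by subsingleton)
  refine ⟨incl 1 _ ≫ S, ?_, ?_⟩
  · have := congrArg (fun r => incl 1 X ≫ r) (hS 0)
    exact this
  · have := congrArg (fun r => incl 1 X ≫ r) (hS 1)
    exact this

theorem Homotopic.symm {X Z : SSet.{u}} [KanComplex Z] {f g : X ⟶ Z} (h : Homotopic f g) :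
    Homotopic g f := h.euclidean (.refl f)

theorem Homotopic.trans {X Z : SSet.{u}} [KanComplex Z] {f g h : X ⟶ Z} (h₁ : Homotopic f g)
    (h₂ : Homotopic g h) : Homotopic f h := h₁.symm.euclidean h₂

theorem Homotopic.of_eqvGen {X Z : SSet.{u}} [KanComplex Z] {f g : X ⟶ Z}
    (h : Relation.EqvGen Homotopic f g) : Homotopic f g := by
  induction h with
  | rel _ _ h => exact h
  | refl _ => exact .refl _
  | symm _ _ _ ih => exact ih.symm
  | trans _ _ _ _ _ ih₁ ih₂ => exact ih₁.trans ih₂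

/-- A Kan fibration of Kan complexes that is bijective on homotopy classes of maps from every
simplicial set has the right lifting property with respect to monomorphisms. -/
theorem rlp_monomorphisms_of_fibration {X Y : SSet.{u}} [KanComplex X] [KanComplex Y] (p : X ⟶ Y)
    [Fibration p] (hsurj : ∀ f : Y ⟶ Y, ∃ g : Y ⟶ X, Homotopic (g ≫ p) f)
    (hinj : ∀ g g' : X ⟶ X, Homotopic (g ≫ p) (g' ≫ p) → Homotopic g g')
    {K L : SSet.{u}} (i : K ⟶ L) [Mono i] (a : K ⟶ X) (b : L ⟶ Y) (hab : a ≫ p = i ≫ b) :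
    ∃ c : L ⟶ X, i ≫ c = a ∧ c ≫ p = b := by
  -- A section up to homotopy is made strict by lifting the homotopy along `p`, with the empty
  -- simplicial set as the subobject.
  obtain ⟨q, hq⟩ : ∃ q : Y ⟶ X, q ≫ p = 𝟙 Y := by
    obtain ⟨g, H, h₀, h₁⟩ := hsurj (𝟙 Y)
    have : Mono (initial.to Y) := mono_of_injective _ fun k x => by
      have : IsEmpty ((⊥_ SSet.{u}).obj k) :=
        ⟨fun z => ((initialIsInitial.to (⊥ : (Δ[0] : SSet.{u}).Subcomplex).toSSet).app k z).2.elim⟩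
      exact isEmptyElim x
    have hi : IsInitial ((⊥_ SSet.{u}) ⊗ Δ[1]) := by
      refine IsInitial.ofUniqueHom (fun Z => fst _ _ ≫ initial.to Z) fun Z m => ?_
      refine hom_ext_apply fun k x => ?_
      exact ((initialIsInitial.to (⊥ : (Δ[0] : SSet.{u}).Subcomplex).toSSet).app k x.1).2.elim
    obtain ⟨H', -, -, h₄⟩ := exists_homotopy_lift 0 (initial.to Y) p g (hi.to X) H
      (by subsingleton) (hi.hom_ext _ _) h₀
    exact ⟨incl 1 Y ≫ H', by rw [Category.assoc, h₄, h₁]⟩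
  obtain ⟨G, hG₀, hG₁⟩ := hinj (𝟙 X) (p ≫ q)
    (by rw [Category.assoc, hq, Category.comp_id, Category.id_comp]; exact .refl p)
  -- The homotopy `G` from the identity to `p ≫ q` need not lie over `Y`. It is compared with `G ≫ p
  -- ≫ q`, which has the same projection: in a square over `G ≫ p` with these two as sides and the
  -- end at 1 constant, the end at 0 is a homotopy from the identity to `p ≫ q` that is constant
  -- over `Y`.
  obtain ⟨S, hS₁, -, hS₃⟩ := exists_square 1 p ![G, G ≫ p ≫ q] (fst _ _ ≫ p ≫ q)
    (fst _ _ ▷ _ ≫ G ≫ p)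
    (fun η => by
      fin_cases η
      · exact hG₁
      · change (incl 1 X ≫ G) ≫ p ≫ q = p ≫ q
        rw [hG₁, Category.assoc, reassoc_of% hq])
    (fun η => by
      fin_cases η
      · rfl
      · change (G ≫ p ≫ q) ≫ p = G ≫ p
        simp only [Category.assoc, hq, Category.comp_id])
    (by
      change fst _ _ ≫ (incl 1 X ≫ G) ≫ p = _
      rw [hG₁, Category.assoc, Category.assoc, Category.assoc])
  have hS : (incl 0 _ ≫ S) ≫ p = fst _ _ ≫ p := by
    rw [Category.assoc, hS₃]
    change fst _ _ ≫ (incl 0 X ≫ G) ≫ p = _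
    rw [hG₀, Category.id_comp]
  have hS0 : incl 0 X ≫ (incl 0 _ ≫ S) = 𝟙 X :=
    (congrArg (fun r => incl 0 X ≫ r) (hS₁ 0)).trans hG₀
  have hS1 : incl 1 X ≫ (incl 0 _ ≫ S) = p ≫ q := by
    refine (congrArg (fun r => incl 0 X ≫ r) (hS₁ 1)).trans ?_
    change (incl 0 X ≫ G) ≫ p ≫ q = p ≫ q
    rw [hG₀, Category.id_comp]
  -- The map `b ≫ q` lifts `b`, but on `K` it is `a ≫ p ≫ q` rather than `a`. Running the vertical
  -- homotopy backwards from the end 1 corrects it without moving the projection.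
  obtain ⟨H', h₁, -, h₃⟩ := exists_homotopy_lift 1 i p (b ≫ q) (a ▷ _ ≫ incl 0 _ ≫ S)
    (fst _ _ ≫ b)
    (by
      change a ≫ (incl 1 X ≫ incl 0 _ ≫ S) = _
      rw [hS1, reassoc_of% hab])
    (by
      have := congrArg (fun r => a ▷ Δ[1] ≫ r) hS
      refine (show _ = _ from this).trans ?_
      change fst _ _ ≫ a ≫ p = fst _ _ ≫ i ≫ b
      rw [hab])
    (by rw [Category.assoc, hq, Category.comp_id]; rfl)
  refine ⟨incl 0 L ≫ H', ?_, ?_⟩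
  · have := congrArg (fun r => incl 0 K ≫ r) h₁
    refine (show _ = _ from this).trans ?_
    change a ≫ (incl 0 X ≫ incl 0 _ ≫ S) = a
    rw [hS0, Category.comp_id]
  · rw [Category.assoc, h₃]
    rfl

end SSet

namespace SSet

open Simplicial HomotopicalAlgebra Limits CartesianMonoidalCategory modelCategoryQuillen

/-! ### Weak equivalences -/

/-- For a Kan target, homotopy is already an equivalence relation, so the quotient identifies
nothing more. -/
theorem hoClass_mk_eq_iff {X Z : SSet.{u}} [KanComplex Z] {f g : X ⟶ Z} :
    (Quot.mk _ f : HoClass X Z) = Quot.mk _ g ↔ Homotopic f g := by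
  constructor
  · intro h
    refine .of_eqvGen ((Quot.eqvGen_exact h).mono fun _ _ => nonempty_homotopy_iff.1)
  · intro h
    exact Quot.sound (nonempty_homotopy_iff.2 h)

theorem isWeakEquiv_iff {X Y : SSet.{u}} (f : X ⟶ Y) :
    IsWeakEquiv f ↔ ∀ Z : SSet.{u}, KanComplex Z →
      (∀ b b' : Y ⟶ Z, Homotopic (f ≫ b) (f ≫ b') → Homotopic b b') ∧
        ∀ a : X ⟶ Z, ∃ b : Y ⟶ Z, Homotopic (f ≫ b) a := by
  refine forall_congr' fun Z => forall_congr' fun hZ => and_congr ?_ ?_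
  · constructor
    · intro h b b' hb
      exact hoClass_mk_eq_iff.1 (h (hoClass_mk_eq_iff.2 hb))
    · rintro h ⟨b⟩ ⟨b'⟩ hb
      exact hoClass_mk_eq_iff.2 (h b b' (hoClass_mk_eq_iff.1 hb))
  · constructor
    · intro h a
      obtain ⟨⟨b⟩, hb⟩ := h (Quot.mk _ a)
      exact ⟨b, hoClass_mk_eq_iff.1 hb⟩
    · rintro h ⟨a⟩
      obtain ⟨b, hb⟩ := h a
      exact ⟨Quot.mk _ b, hoClass_mk_eq_iff.2 hb⟩

/-- Extension of maps gives surjectivity on homotopy classes, and extension of homotopies with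
prescribed ends gives injectivity. -/
theorem isWeakEquiv_of_extension {X Y : SSet.{u}} (f : X ⟶ Y)
    (h₁ : ∀ (Z : SSet.{u}) [KanComplex Z] (a : X ⟶ Z), ∃ b : Y ⟶ Z, f ≫ b = a)
    (h₂ : ∀ (Z : SSet.{u}) [KanComplex Z] (H : X ⊗ Δ[1] ⟶ Z) (b : Fin 2 → (Y ⟶ Z)),
      (∀ ε, incl ε X ≫ H = f ≫ b ε) →
        ∃ H' : Y ⊗ Δ[1] ⟶ Z, f ▷ _ ≫ H' = H ∧ ∀ ε, incl ε Y ≫ H' = b ε) :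
    IsWeakEquiv f := by
  refine (isWeakEquiv_iff f).2 fun Z hZ => ⟨?_, fun a => ?_⟩
  · rintro b b' ⟨H, h₀, h₁⟩
    obtain ⟨H', -, h⟩ := h₂ Z H ![b, b'] (fun ε => by fin_cases ε <;> assumption)
    exact ⟨H', h 0, h 1⟩
  · obtain ⟨b, rfl⟩ := h₁ Z a
    exact ⟨b, .refl _⟩

theorem mono_whiskerLeft {A B : SSet.{u}} (i : A ⟶ B) [Mono i] (K : SSet.{u}) : Mono (K ◁ i) :=
  mono_of_injective _ fun k => by
    rintro ⟨x, s⟩ ⟨y, t⟩ h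
    have h' : (x, i.app k s) = (y, i.app k t) := h
    exact Prod.ext (Prod.mk.inj h').1 (injective_of_mono i k (Prod.mk.inj h').2)

theorem anodyneExtensions.isWeakEquiv {X Y : SSet.{u}} {f : X ⟶ Y}
    (hf : anodyneExtensions f) : IsWeakEquiv f := by
  refine isWeakEquiv_of_extension f (fun Z _ a => ?_) (fun Z _ H b hb => ?_)
  · have := hf (terminal.from Z) (by have := fibration_terminal Z; exact mem_fibrations _)
    have sq : CommSq a f (terminal.from Z) (terminal.from Y) := ⟨by subsingleton⟩
    exact ⟨sq.lift, sq.fac_left⟩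
  · have h : (boundary.{u} 1 : SSet.{u}) ◁ f ≫ (β_ _ _).hom ≫ boundaryDesc b =
        (boundary.{u} 1).ι ▷ X ≫ (β_ _ _).hom ≫ H := by
      refine hom_ext_apply ?_
      rintro k ⟨⟨s, hs⟩, x⟩
      obtain ⟨ε, rfl⟩ := mem_boundary_one.1 hs
      exact (congr_apply (hb ε) k x).symm
    obtain ⟨χ, h₁, h₂⟩ := exists_extension_pushoutProduct (boundary.{u} 1).ι hf _ _ h
    refine ⟨(β_ _ _).hom ≫ χ, hom_ext_apply fun k x => ?_, fun ε => hom_ext_apply fun k x => ?_⟩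
    · exact congr_apply h₂ k (x.2, x.1)
    · exact congr_apply h₁ k (⟨stdSimplex.const 1 ε k, mem_boundary_one.2 ⟨ε, rfl⟩⟩, x)

theorem homotopic_curry_iff {A L Z : SSet.{u}} {f g : A ⊗ L ⟶ Z} :
    Homotopic (MonoidalClosed.curry f) (MonoidalClosed.curry g) ↔ Homotopic f g := by
  constructor
  · rintro ⟨H, h₀, h₁⟩
    refine ⟨(α_ _ _ _).hom ≫ MonoidalClosed.uncurry H, ?_, ?_⟩
    · rw [← MonoidalClosed.uncurry_curry f, ← h₀, MonoidalClosed.uncurry_natural_left]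
      rfl
    · rw [← MonoidalClosed.uncurry_curry g, ← h₁, MonoidalClosed.uncurry_natural_left]
      rfl
  · rintro ⟨H, rfl, rfl⟩
    refine ⟨MonoidalClosed.curry ((α_ _ _ _).inv ≫ H), ?_, ?_⟩
    · rw [← MonoidalClosed.curry_natural_left]
      rfl
    · rw [← MonoidalClosed.curry_natural_left]
      rfl

theorem homotopic_uncurry_iff {A L Z : SSet.{u}} {f g : L ⟶ (ihom A).obj Z} :
    Homotopic (MonoidalClosed.uncurry f) (MonoidalClosed.uncurry g) ↔ Homotopic f g := by
  rw [← homotopic_curry_iff, MonoidalClosed.curry_uncurry, MonoidalClosed.curry_uncurry]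

theorem homotopic_braiding_iff {A L Z : SSet.{u}} {f g : A ⊗ L ⟶ Z} :
    Homotopic ((β_ L A).hom ≫ f) ((β_ L A).hom ≫ g) ↔ Homotopic f g := by
  refine ⟨fun h => ?_, fun h => h.comp_left _⟩
  have := h.comp_left (β_ L A).inv
  rwa [Iso.inv_hom_id_assoc, Iso.inv_hom_id_assoc] at this

/-- Extension of maps to a Kan complex along the pushout-product of a monomorphism and a
monomorphism that is a weak equivalence. -/
theorem IsWeakEquiv.exists_extension {A B K L Z : SSet.{u}} [KanComplex Z] {i : A ⟶ B}
    (hi : IsWeakEquiv i) [Mono i] (j : K ⟶ L) [Mono j] (a : A ⊗ L ⟶ Z) (b : B ⊗ K ⟶ Z)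
    (hab : A ◁ j ≫ a = i ▷ K ≫ b) :
    ∃ χ : B ⊗ L ⟶ Z, i ▷ L ≫ χ = a ∧ B ◁ j ≫ χ = b := by
  have key : ∀ {M : SSet.{u}} (f : M ⟶ (ihom B).obj Z),
      MonoidalClosed.uncurry (f ≫ (MonoidalClosed.pre i).app Z) =
        i ▷ M ≫ MonoidalClosed.uncurry f := by
    intro M f
    rw [← MonoidalClosed.curry_uncurry f, MonoidalClosed.curry_pre_app,
      MonoidalClosed.uncurry_curry, MonoidalClosed.uncurry_curry]
  -- Exchanging variables, a map M → Z ^ A is a map A → Z ^ M. As Z ^ M is Kan, the hypothesis on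
  -- `i` makes Z ^ B → Z ^ A bijective on homotopy classes of maps out of M.
  have hsurj : ∀ f : (ihom A).obj Z ⟶ (ihom A).obj Z, ∃ g : (ihom A).obj Z ⟶ (ihom B).obj Z,
      Homotopic (g ≫ (MonoidalClosed.pre i).app Z) f := by
    intro f
    obtain ⟨g, hg⟩ := ((isWeakEquiv_iff i).1 hi _ inferInstance).2
      (MonoidalClosed.curry ((β_ _ _).hom ≫ MonoidalClosed.uncurry f))
    refine ⟨MonoidalClosed.curry ((β_ _ _).hom ≫ MonoidalClosed.uncurry g), ?_⟩
    rw [← homotopic_uncurry_iff, key, MonoidalClosed.uncurry_curry, ← homotopic_braiding_iff]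
    rw [← homotopic_uncurry_iff, MonoidalClosed.uncurry_curry,
      MonoidalClosed.uncurry_natural_left] at hg
    exact hg
  have hinj : ∀ f g : (ihom B).obj Z ⟶ (ihom B).obj Z,
      Homotopic (f ≫ (MonoidalClosed.pre i).app Z) (g ≫ (MonoidalClosed.pre i).app Z) →
        Homotopic f g := by
    intro f g h
    rw [← homotopic_uncurry_iff, key, key, ← homotopic_braiding_iff] at h
    have := ((isWeakEquiv_iff i).1 hi _ inferInstance).1
      (MonoidalClosed.curry ((β_ _ _).hom ≫ MonoidalClosed.uncurry f))
      (MonoidalClosed.curry ((β_ _ _).hom ≫ MonoidalClosed.uncurry g)) (by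
        rw [← homotopic_uncurry_iff, MonoidalClosed.uncurry_natural_left,
          MonoidalClosed.uncurry_natural_left, MonoidalClosed.uncurry_curry,
          MonoidalClosed.uncurry_curry]
        exact h)
    rw [homotopic_curry_iff, homotopic_braiding_iff, homotopic_uncurry_iff] at this
    exact this
  -- Restriction Z ^ B → Z ^ A is a Kan fibration of Kan complexes, so it lifts against `j`;
  -- transposing the lift gives the extension.
  obtain ⟨c, h₁, h₂⟩ := rlp_monomorphisms_of_fibration ((MonoidalClosed.pre i).app Z) hsurj hinj j
    (MonoidalClosed.curry b) (MonoidalClosed.curry a)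
    (by rw [MonoidalClosed.curry_pre_app, ← MonoidalClosed.curry_natural_left, hab])
  refine ⟨MonoidalClosed.uncurry c, ?_, ?_⟩
  · rw [← key, h₂, MonoidalClosed.uncurry_curry]
  · rw [← MonoidalClosed.uncurry_natural_left, h₁, MonoidalClosed.uncurry_curry]

end SSet

namespace PSSet

open Simplicial HomotopicalAlgebra SSet modelCategoryQuillen

theorem hom_ext_apply {X Y : PSSet.{u}} {f g : X ⟶ Y}
    (h : ∀ k x, Hom.ap f k x = Hom.ap g k x) : f = g :=
  Hom.ext (SSet.hom_ext_apply h)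

theorem Hom.ap_map {X Y : PSSet.{u}} (f : X ⟶ Y) {k l : SimplexCategoryᵒᵖ} (θ : k ⟶ l)
    (x : X.S k) : Hom.ap f l (X.toSSet.map θ x) = Y.toSSet.map θ (Hom.ap f k x) :=
  NatTrans.naturality_apply (Hom.hom f) θ x

/-! ### Simplices of smash products -/

open Classical in
theorem smash.mk_eq_mk {X K : PSSet.{u}} {k : SimplexCategoryᵒᵖ} {x y : X.S k} {a b : K.S k}
    (h : smash.mk x a = smash.mk y b) :
    (x = y ∧ a = b) ∨ ((x = X.pt k ∨ a = K.pt k) ∧ (y = X.pt k ∨ b = K.pt k)) := by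
  -- Equality in the quotient is detected by this function, which sends the two axes to `none` and
  -- is injective off them.
  let F : (smash X K).S k → Option (X.S k × K.S k) :=
    smash.lift (fun x a => if x = X.pt k ∨ a = K.pt k then none else some (x, a)) none
      (fun a => by simp) (fun x => by simp)
  have hF : (if x = X.pt k ∨ a = K.pt k then none else some (x, a)) =
      if y = X.pt k ∨ b = K.pt k then none else some (y, b) := congrArg F h
  split_ifs at hF with h₁ h₂ h₂
  · exact .inr ⟨h₁, h₂⟩
  · exact .inl (Prod.mk.inj (Option.some.inj hF))

/-- The simplex `x ∧ a` of `X ∧ L₊`. -/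
def smash.mkPlus {X : PSSet.{u}} {L : SSet.{u}} {k : SimplexCategoryᵒᵖ} (x : X.S k)
    (a : L.obj k) : (smash X (plus L)).S k :=
  smash.mk (K := plus L) x (some a)

@[simp]
theorem smash.mkPlus_pt {X : PSSet.{u}} {L : SSet.{u}} {k : SimplexCategoryᵒᵖ} (a : L.obj k) :
    smash.mkPlus (X.pt k) a = (smash X (plus L)).pt k :=
  smash.mk_pt_left _

theorem smash.mkPlus_eq_pt {X : PSSet.{u}} {L : SSet.{u}} {k : SimplexCategoryᵒᵖ} {x : X.S k}
    {a : L.obj k} (h : smash.mkPlus x a = (smash X (plus L)).pt k) : x = X.pt k := by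
  rcases smash.mk_eq_mk (y := X.pt k) (b := (plus L).pt k) h with ⟨h₁, -⟩ | ⟨h₁ | h₁, -⟩
  · exact h₁
  · exact h₁
  · cases h₁

theorem smash.mkPlus_eq_mkPlus {X : PSSet.{u}} {L : SSet.{u}} {k : SimplexCategoryᵒᵖ} {x y : X.S k}
    {a b : L.obj k}
    (h : smash.mkPlus x a = smash.mkPlus y b) :
    (x = y ∧ a = b) ∨ (x = X.pt k ∧ y = X.pt k) := by
  rcases smash.mk_eq_mk h with ⟨h₁, h₂⟩ | ⟨h₁ | h₁, h₂ | h₂⟩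
  · exact .inl ⟨h₁, Option.some.inj h₂⟩
  · exact .inr ⟨h₁, h₂⟩
  all_goals cases h₁
  all_goals cases h₂

theorem smash.exists_mkPlus {X : PSSet.{u}} {L : SSet.{u}} {k : SimplexCategoryᵒᵖ}
    (z : (smash X (plus L)).S k) :
    z = (smash X (plus L)).pt k ∨ ∃ x a, z = smash.mkPlus x a := by
  obtain ⟨x, a⟩ := z
  cases a with
  | none => exact .inl (smash.mk_pt_right x)
  | some a => exact .inr ⟨x, a, rfl⟩

/-- The map `X ∧ f : X ∧ K ⟶ X ∧ K'`. -/
def smash.mapRight (X : PSSet.{u}) {K K' : PSSet.{u}} (f : K ⟶ K') : smash X K ⟶ smash X K' :=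
  homMk (fun k => smash.lift (fun x a => smash.mk x (Hom.ap f k a)) ((smash X K').pt k)
      (fun a => by simp) (fun x => by simp))
    (by
      rintro k l θ ⟨x, a⟩
      exact congrArg (fun b => smash.mk _ b) (Hom.ap_map f θ a))
    (fun k => by
      exact congrArg (fun b => smash.mk _ b) (Hom.app_pt f k))

/-- The map `K₊ ⟶ L₊` induced by `j : K ⟶ L`. -/
def plusMap {K L : SSet.{u}} (j : K ⟶ L) : plus K ⟶ plus L :=
  homMk (fun k => Option.map (j.app k))
    (by
      rintro k l θ (_ | a)
      · rfl
      · exact congrArg some (NatTrans.naturality_apply j θ a))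
    (fun _ => rfl)

/-- The quotient map `X × L ⟶ X ∧ L₊`. -/
def toSmashPlus (X : PSSet.{u}) (L : SSet.{u}) : X.toSSet ⊗ L ⟶ (smash X (plus L)).toSSet :=
  SSet.ofFun (fun _ x => smash.mkPlus x.1 x.2) (fun _ _ => rfl)

/-- A map out of `X ∧ L₊` from a map on `X × L` that is constant on `* × L`. -/
def smashPlusDesc {X : PSSet.{u}} {L Z : SSet.{u}} (F : X.toSSet ⊗ L ⟶ Z) (c : ∀ k, Z.obj k)
    (hc : ∀ {k l : SimplexCategoryᵒᵖ} (θ : k ⟶ l), Z.map θ (c k) = c l)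
    (h : ∀ k a, F.app k (X.pt k, a) = c k) : (smash X (plus L)).toSSet ⟶ Z :=
  SSet.ofFun (fun k => smash.lift
      (fun x a => Option.elim a (c k) fun b => F.app k (x, b)) (c k)
      (fun a => by cases a with
        | none => rfl
        | some a => exact h k a) (fun _ => rfl)) (by
    rintro k l θ ⟨x, _ | a⟩
    · exact (hc θ).symm
    · exact NatTrans.naturality_apply F θ ((x, a) : (X.toSSet ⊗ L).obj k))

/-- A map out of `(X ∧ L₊) × K` from a map on `X × (L × K)` that is constant on `* × L`. -/
def smashPlusProdDesc {X : PSSet.{u}} {L K Z : SSet.{u}} (F : X.toSSet ⊗ (L ⊗ K) ⟶ Z) (c : K ⟶ Z)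
    (h : ∀ k a b, F.app k (X.pt k, (a, b)) = c.app k b) :
    (smash X (plus L)).toSSet ⊗ K ⟶ Z :=
  SSet.ofFun (fun k z => smash.lift
      (fun x a => Option.elim a (c.app k z.2) fun b => F.app k (x, (b, z.2))) (c.app k z.2)
      (fun a => by cases a with
        | none => rfl
        | some a => exact h k a _) (fun _ => rfl) z.1) (by
    rintro k l θ ⟨⟨x, _ | a⟩, b⟩
    · exact NatTrans.naturality_apply c θ b
    · exact NatTrans.naturality_apply F θ ((x, (a, b)) : (X.toSSet ⊗ (L ⊗ K)).obj k))

theorem smashPlus_hom_ext {X : PSSet.{u}} {L Z : SSet.{u}} {f g : (smash X (plus L)).toSSet ⟶ Z}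
    (hpt : ∀ k, f.app k ((smash X (plus L)).pt k) = g.app k ((smash X (plus L)).pt k))
    (h : ∀ k x a, f.app k (smash.mkPlus x a) = g.app k (smash.mkPlus x a)) : f = g := by
  refine SSet.hom_ext_apply fun k z => ?_
  rcases smash.exists_mkPlus z with rfl | ⟨x, a, rfl⟩
  · exact hpt k
  · exact h k x a

theorem app_pt_natural {X : PSSet.{u}} {Z : SSet.{u}} (f : X.toSSet ⟶ Z) {k l : SimplexCategoryᵒᵖ}
    (θ : k ⟶ l) : Z.map θ (f.app k (X.pt k)) = f.app l (X.pt l) :=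
  (NatTrans.naturality_apply f θ (X.pt k)).symm.trans (congrArg (f.app l) (X.map_pt θ))

/-- Smashing with `L₊` preserves injective weak equivalences. -/
theorem isWeakEquiv_smash_map_plus {X Y : PSSet.{u}} (f : X ⟶ Y)
    (hinj : ∀ k, Function.Injective (Hom.ap f k)) (hf : IsWeakEquiv (Hom.hom f)) (L : SSet.{u}) :
    IsWeakEquiv (Hom.hom (smash.map f (plus L))) := by
  have : Mono (Hom.hom f) := mono_of_injective _ hinj
  refine isWeakEquiv_of_extension _ (fun Z _ a => ?_) (fun Z _ H b hb => ?_)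
  -- With the empty subcomplex for `j`, this is plain extension along `f` × L.
  · obtain ⟨χ, hχ, -⟩ := hf.exists_extension (⊥ : L.Subcomplex).ι (toSmashPlus X L ≫ a)
      (SSet.ofFun (fun k x => x.2.2.elim) (fun _ x => x.2.2.elim))
      (SSet.hom_ext_apply fun k x => x.2.2.elim)
    -- The base point of Y is the image of that of X, so the extension is automatically constant on
    -- * × L and descends to the smash product.
    have hpt : ∀ k b, χ.app k (Y.pt k, b) = a.app k ((smash X (plus L)).pt k) := by
      intro k b
      rw [← Hom.app_pt f k]
      refine (SSet.congr_apply hχ k (X.pt k, b)).trans ?_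
      exact congrArg (a.app k) (smash.mk_pt_left _)
    let D := smashPlusDesc χ (fun k => a.app k ((smash X (plus L)).pt k)) (app_pt_natural a) hpt
    refine ⟨D, smashPlus_hom_ext (fun k => ?_) (fun k x b => ?_)⟩
    · exact congrArg (fun w => D.app k w) (Hom.app_pt (smash.map f (plus L)) k)
    · exact SSet.congr_apply hχ k (x, b)
  · have := mono_whiskerLeft (boundary.{u} 1).ι L
    -- A homotopy on Y ∧ L₊ is a map on Y × (L × Δ[1]), here prescribed on L × ∂Δ[1]. On the base
    -- point it runs along the path `c`, since homotopies are unpointed.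
    obtain ⟨χ, h₁, h₂⟩ := hf.exists_extension (L ◁ (boundary.{u} 1).ι)
      ((α_ _ _ _).inv ≫ toSmashPlus X L ▷ _ ≫ H)
      ((α_ _ _ _).inv ≫ boundaryDesc fun ε => toSmashPlus Y L ≫ b ε) (by
        refine SSet.hom_ext_apply ?_
        rintro k ⟨x, a, ⟨s, hs⟩⟩
        obtain ⟨ε, rfl⟩ := mem_boundary_one.1 hs
        exact SSet.congr_apply (hb ε) k (smash.mkPlus x a))
    let c : Δ[1] ⟶ Z := SSet.ofFun (fun k s => H.app k ((smash X (plus L)).pt k, s))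
      (fun {k l} θ s => by
        refine Eq.trans ?_ (NatTrans.naturality_apply H θ
          (((smash X (plus L)).pt k, s) : ((smash X (plus L)).toSSet ⊗ Δ[1]).obj k))
        exact congrArg (fun z => H.app l (z, Δ1.map θ s)) (map_pt _ θ).symm)
    have hpt : ∀ k a s, χ.app k (Y.pt k, (a, s)) = c.app k s := by
      intro k a s
      rw [← Hom.app_pt f k]
      refine (SSet.congr_apply h₁ k (X.pt k, (a, s))).trans ?_
      exact congrArg (fun z => H.app k (z, s)) (smash.mk_pt_left _)
    let D := smashPlusProdDesc χ c hpt
    refine ⟨D, ?_, ?_⟩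
    · refine SSet.hom_ext_apply ?_
      rintro k ⟨z, s⟩
      rcases smash.exists_mkPlus z with rfl | ⟨x, a, rfl⟩
      · exact congrArg (fun w => D.app k (w, s)) (Hom.app_pt (smash.map f (plus L)) k)
      · exact SSet.congr_apply h₁ k (x, (a, s))
    · intro ε
      refine smashPlus_hom_ext (fun k => ?_) (fun k y a => ?_)
      · refine (SSet.congr_apply (hb ε) k ((smash X (plus L)).pt k)).trans ?_
        exact congrArg ((b ε).app k) (Hom.app_pt (smash.map f (plus L)) k)
      · exact SSet.congr_apply h₂ k
          (y, (a, ⟨stdSimplex.const 1 ε k, mem_boundary_one.2 ⟨ε, rfl⟩⟩))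

theorem smash_map_plus_injective {X Y : PSSet.{u}} (f : X ⟶ Y) (L : SSet.{u})
    (k : SimplexCategoryᵒᵖ) (hf : Function.Injective (Hom.ap f k)) :
    Function.Injective (Hom.ap (smash.map f (plus L)) k) := by
  have hpt : ∀ {x}, Hom.ap f k x = Y.pt k → x = X.pt k := fun h =>
    hf (h.trans (Hom.app_pt f k).symm)
  intro z w h
  rcases smash.exists_mkPlus z with rfl | ⟨x, a, rfl⟩ <;>
    rcases smash.exists_mkPlus w with rfl | ⟨y, b, rfl⟩
  · rfl
  · rw [hpt (x := y) (smash.mkPlus_eq_pt (h.symm.trans (Hom.app_pt _ k))), smash.mkPlus_pt]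
  · rw [hpt (x := x) (smash.mkPlus_eq_pt (h.trans (Hom.app_pt _ k))), smash.mkPlus_pt]
  · rcases smash.mkPlus_eq_mkPlus (x := Hom.ap f k x) (y := Hom.ap f k y) h with
      ⟨h₁, rfl⟩ | ⟨h₁, h₂⟩
    · rw [hf h₁]
    · rw [hpt h₁, hpt h₂, smash.mkPlus_pt, smash.mkPlus_pt]

/-- The pushout-product of an injection of pointed simplicial sets and an anodyne extension. -/
theorem anodyneExtensions_glue_desc_smash {A B : PSSet.{u}} (i : A ⟶ B)
    (hi : ∀ k, Function.Injective (Hom.ap i k)) {K L : SSet.{u}} {j : K ⟶ L}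
    (hj : anodyneExtensions j)
    (h : ∀ k a, Hom.ap (smash.map i (plus L)) k (Hom.ap (smash.mapRight A (plusMap j)) k a) =
      Hom.ap (smash.mapRight B (plusMap j)) k (Hom.ap (smash.map i (plus K)) k a)) :
    anodyneExtensions (Hom.hom (glue.desc (smash.map i (plus L))
      (smash.mapRight B (plusMap j)) h)) := by
  have : Mono (Hom.hom i) := mono_of_injective _ hi
  intro S T p hp
  have : Fibration p := (HomotopicalAlgebra.fibration_iff p).2 hp
  refine ⟨fun {t b} sq => ?_⟩
  let P := glue (smash.mapRight A (plusMap j)) (smash.map i (plus K))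
  let t₁ : (smash A (plus L)).toSSet ⟶ S :=
    Hom.hom (glue.inl (smash.mapRight A (plusMap j)) (smash.map i (plus K))) ≫ t
  let t₂ : (smash B (plus K)).toSSet ⟶ S :=
    Hom.hom (glue.inr (smash.mapRight A (plusMap j)) (smash.map i (plus K))) ≫ t
  have hpt₁ : ∀ k, t₁.app k ((smash A (plus L)).pt k) = t.app k (P.pt k) := fun k => rfl
  have hpt₂ : ∀ k, t₂.app k ((smash B (plus K)).pt k) = t.app k (P.pt k) := fun k =>
    congrArg (t.app k) (Hom.app_pt (glue.inr _ _) k)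
  -- Pull the lifting problem back to the unpointed products. The lift found there is constant on
  -- the base point of B, which comes from A, and so descends.
  obtain ⟨χ, h₁, h₂, h₃⟩ := exists_lift_pushoutProduct (Hom.hom i) hj p
    (toSmashPlus A L ≫ t₁) (toSmashPlus B K ≫ t₂) (toSmashPlus B L ≫ b)
    (SSet.hom_ext_apply fun k x =>
      congrArg (t.app k) (glue.condition (f := smash.mapRight A (plusMap j))
        (g := smash.map i (plus K)) k (smash.mkPlus x.1 x.2)))
    (SSet.hom_ext_apply fun k x =>
      SSet.congr_apply sq.w k (Hom.ap (glue.inl _ _) k (smash.mkPlus x.1 x.2)))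
    (SSet.hom_ext_apply fun k x =>
      SSet.congr_apply sq.w k (Hom.ap (glue.inr _ _) k (smash.mkPlus x.1 x.2)))
  have hpt : ∀ k a, χ.app k (B.pt k, a) = t.app k (P.pt k) := by
    intro k a
    rw [← Hom.app_pt i k]
    refine (SSet.congr_apply h₁ k (A.pt k, a)).trans ?_
    exact congrArg (t₁.app k) (smash.mk_pt_left _)
  let D := smashPlusDesc χ (fun k => t.app k (P.pt k)) (app_pt_natural t) hpt
  refine ⟨⟨⟨D, ?_, ?_⟩⟩⟩
  · refine SSet.hom_ext_apply fun k => ?_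
    rintro ⟨z | z⟩
    · rcases smash.exists_mkPlus z with rfl | ⟨x, a, rfl⟩
      · exact congrArg (fun w => D.app k w) (Hom.app_pt (smash.map i (plus L)) k)
      · exact SSet.congr_apply h₁ k (x, a)
    · rcases smash.exists_mkPlus z with rfl | ⟨x, a, rfl⟩
      · refine Eq.trans ?_ (hpt₂ k).symm
        exact congrArg (fun w => D.app k w) (Hom.app_pt (smash.mapRight B (plusMap j)) k)
      · exact SSet.congr_apply h₂ k (x, a)
  · refine smashPlus_hom_ext (fun k => ?_) (fun k x a => SSet.congr_apply h₃ k (x, a))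
    refine (SSet.congr_apply sq.w k (P.pt k)).trans ?_
    exact congrArg (b.app k) (Hom.app_pt (glue.desc (smash.map i (plus L))
      (smash.mapRight B (plusMap j)) h) k)

end PSSet

/-! ### Simplices of the internal hom -/

namespace SSet

/-- The value of a simplex of the internal hom. -/
abbrev ihomEval {L Y : SSet.{u}} {k : SimplexCategoryᵒᵖ} (a : ((ihom L).obj Y).obj k)
    (l : SimplexCategoryᵒᵖ) (θ : k ⟶ l) (x : L.obj l) : Y.obj l :=
  Functor.HomObj.app a l θ x

/-- A simplex of the internal hom from its values. -/
def ihomMk {L Y : SSet.{u}} {k : SimplexCategoryᵒᵖ} (F : ∀ l, (k ⟶ l) → L.obj l → Y.obj l)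
    (nat : ∀ {l m : SimplexCategoryᵒᵖ} (η : l ⟶ m) (θ : k ⟶ l) (x : L.obj l),
      F m (θ ≫ η) (L.map η x) = Y.map η (F l θ x)) : ((ihom L).obj Y).obj k :=
  { app := fun l θ => ↾fun x => F l θ x
    naturality := fun {l m} η θ => by
      ext x
      exact nat η θ x }

theorem ihom_ext {L Y : SSet.{u}} {k : SimplexCategoryᵒᵖ} {a b : ((ihom L).obj Y).obj k}
    (h : ∀ l θ x, ihomEval a l θ x = ihomEval b l θ x) : a = b := by
  refine Functor.HomObj.ext (funext fun l => funext fun θ => ?_)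
  ext x
  exact h l θ x

theorem ihomEval_map {L Y : SSet.{u}} {k : SimplexCategoryᵒᵖ} (a : ((ihom L).obj Y).obj k)
    {l m : SimplexCategoryᵒᵖ} (η : l ⟶ m) (θ : k ⟶ l) (x : L.obj l) :
    ihomEval a m (θ ≫ η) (L.map η x) = Y.map η (ihomEval a l θ x) :=
  ConcreteCategory.congr_hom (Functor.HomObj.naturality a η θ) x

end SSet

/-! ### Families of maps, cotensors and mapping spaces -/

namespace SymSpec

open PSSet SSet

theorem hom_ext_apply {X Y : SymSpec.{u}} {f g : X ⟶ Y} (h : ∀ n k x, ap f n k x = ap g n k x) :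
    f = g :=
  Hom.ext (funext fun n => PSSet.hom_ext_apply (h n))

theorem congr_ap {X Y : SymSpec.{u}} {f g : X ⟶ Y} (h : f = g) (n : ℕ) (k : SimplexCategoryᵒᵖ)
    (x : (X.lvl n).S k) : ap f n k x = ap g n k x := by
  rw [h]

/-- Maps `X × L → E` that are maps of symmetric spectra in the first variable. They correspond to
maps `X ∧ L₊ ⟶ E`. -/
@[ext]
structure ParamHom (X : SymSpec.{u}) (L : SimplexCategoryᵒᵖ ⥤ Type v) (E : SymSpec.{u}) where
  app : ∀ n k, (X.lvl n).S k → L.obj k → (E.lvl n).S k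
  app_map : ∀ n {k l : SimplexCategoryᵒᵖ} (θ : k ⟶ l) x a,
    app n l ((X.lvl n).toSSet.map θ x) (L.map θ a) = (E.lvl n).toSSet.map θ (app n k x a)
  app_pt : ∀ n k a, app n k ((X.lvl n).pt k) a = (E.lvl n).pt k
  app_act : ∀ n π k x a, app n k (PSSet.Hom.ap (X.act n π) k x) a =
    PSSet.Hom.ap (E.act n π) k (app n k x a)
  app_susp : ∀ k n x t a, app (n + 1) k (X.susp k n x t) a = E.susp k n (app n k x a) t

namespace ParamHom

variable {X Y E : SymSpec.{u}}

theorem ext_apply {L : SimplexCategoryᵒᵖ ⥤ Type v} {φ ψ : ParamHom X L E}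
    (h : ∀ n k x a, φ.app n k x a = ψ.app n k x a) : φ = ψ :=
  ParamHom.ext (funext fun n => funext fun k => funext fun x => funext fun a => h n k x a)

theorem congr_app {L : SimplexCategoryᵒᵖ ⥤ Type v} {φ ψ : ParamHom X L E} (h : φ = ψ) (n : ℕ)
    (k : SimplexCategoryᵒᵖ) (x : (X.lvl n).S k) (a : L.obj k) :
    φ.app n k x a = ψ.app n k x a := by
  rw [h]

/-- Precomposition in the second variable. -/
def precomp {L : SimplexCategoryᵒᵖ ⥤ Type v} {K : SimplexCategoryᵒᵖ ⥤ Type w} (φ : ParamHom X L E)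
    (j : ∀ k, K.obj k → L.obj k)
    (hj : ∀ {k l : SimplexCategoryᵒᵖ} (θ : k ⟶ l) a, j l (K.map θ a) = L.map θ (j k a)) :
    ParamHom X K E where
  app n k x a := φ.app n k x (j k a)
  app_map n k l θ x a := by rw [hj, φ.app_map]
  app_pt n k a := φ.app_pt n k _
  app_act n π k x a := φ.app_act n π k x _
  app_susp k n x t a := φ.app_susp k n x t _

/-- Restriction along a map of simplicial sets. -/
def res {K L : SSet.{u}} (φ : ParamHom X L E) (j : K ⟶ L) : ParamHom X K E :=
  φ.precomp (fun k => j.app k) (fun θ a => NatTrans.naturality_apply j θ a)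

/-- Precomposition with a map of symmetric spectra. -/
def pre {L : SimplexCategoryᵒᵖ ⥤ Type v} (f : X ⟶ Y) (φ : ParamHom Y L E) : ParamHom X L E where
  app n k x a := φ.app n k (ap f n k x) a
  app_map n k l θ x a := by rw [ap, PSSet.Hom.ap_map, φ.app_map]
  app_pt n k a :=
    (congrArg (φ.app n k · a) (PSSet.Hom.app_pt (Hom.lvl f n) k)).trans (φ.app_pt n k a)
  app_act n π k x a := by rw [ap, Hom.lvl_act, φ.app_act]
  app_susp k n x t a := by rw [ap, Hom.lvl_susp, φ.app_susp]

/-- The maps `X ⟶ E` parametrized by the simplices of `L`. -/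
def eval {L : SSet.{u}} (φ : ParamHom X L E) (a : ∀ k, L.obj k)
    (ha : ∀ {k l : SimplexCategoryᵒᵖ} (θ : k ⟶ l), L.map θ (a k) = a l) : X ⟶ E where
  lvl n := homMk (fun k x => φ.app n k x (a k))
    (fun {k l} θ x => by rw [← φ.app_map, ha]) (fun k => φ.app_pt n k _)
  lvl_act n π k x := φ.app_act n π k x _
  lvl_susp k n x t := φ.app_susp k n x t _

/-- The map of symmetric spectra at the vertex `ε` of `Δ[1]`. -/
def atVertex (ε : Fin 2) (φ : ParamHom X Δ1.{u} E) : X ⟶ E :=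
  φ.eval (fun k => stdSimplex.const 1 ε k) (map_const ε)

/-- A map of symmetric spectra, seen as a constant family. -/
def const (L : SimplexCategoryᵒᵖ ⥤ Type v) (f : X ⟶ E) : ParamHom X L E where
  app n k x _ := ap f n k x
  app_map _ _ _ θ x _ := PSSet.Hom.ap_map _ θ x
  app_pt _ k _ := PSSet.Hom.app_pt _ k
  app_act n π k x _ := Hom.lvl_act f n π k x
  app_susp k n x t _ := Hom.lvl_susp f k n x t

/-- The map `X ∧ L₊ ⟶ E` given by a family. -/
def toSmash {L : SSet.{u}} (φ : ParamHom X L E) : X.smash (plus L) ⟶ E where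
  lvl n := homMk (fun k => PSSet.smash.lift
      (fun x a => Option.elim a ((E.lvl n).pt k) fun b => φ.app n k x b) ((E.lvl n).pt k)
      (fun a => by cases a with
        | none => rfl
        | some a => exact φ.app_pt n k a) (fun _ => rfl))
    (by
      rintro k l θ ⟨x, _ | a⟩
      · exact (map_pt _ θ).symm
      · exact φ.app_map n θ x a)
    (fun k => rfl)
  lvl_act := by
    rintro n π k ⟨x, _ | a⟩
    · exact (PSSet.Hom.app_pt _ k).symm
    · exact φ.app_act n π k x a
  lvl_susp := by
    rintro k n ⟨x, _ | a⟩ t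
    · exact (E.susp_pt_left k n t).symm
    · exact φ.app_susp k n x t a

/-- The family given by a map `X ∧ L₊ ⟶ E`. -/
def ofSmash {L : SSet.{u}} (f : X.smash (plus L) ⟶ E) : ParamHom X L E where
  app n k x a := ap f n k (smash.mkPlus x a)
  app_map n k l θ x a := PSSet.Hom.ap_map (Hom.lvl f n) θ (smash.mkPlus x a)
  app_pt n k a := by rw [smash.mkPlus_pt]; exact PSSet.Hom.app_pt (Hom.lvl f n) k
  app_act n π k x a := Hom.lvl_act f n π k (smash.mkPlus x a)
  app_susp k n x t a := Hom.lvl_susp f k n (smash.mkPlus x a) t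

theorem ofSmash_toSmash {L : SSet.{u}} (φ : ParamHom X L E) : ofSmash φ.toSmash = φ := rfl

end ParamHom

theorem smashPlus_hom_ext {X E : SymSpec.{u}} {L : SSet.{u}} {f g : X.smash (plus L) ⟶ E}
    (h : ∀ n k x a, ap f n k (smash.mkPlus x a) = ap g n k (smash.mkPlus x a)) : f = g := by
  refine hom_ext_apply fun n k z => ?_
  rcases smash.exists_mkPlus z with rfl | ⟨x, a, rfl⟩
  · exact (PSSet.Hom.app_pt (Hom.lvl f n) k).trans (PSSet.Hom.app_pt (Hom.lvl g n) k).symm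
  · exact h n k x a

theorem homotopyRel_iff {X E : SymSpec.{u}} {f g : X ⟶ E} :
    HomotopyRel f g ↔ ∃ φ : ParamHom X Δ1 E, φ.atVertex 0 = f ∧ φ.atVertex 1 = g := by
  constructor
  · rintro ⟨H, rfl, rfl⟩
    exact ⟨.ofSmash H, rfl, rfl⟩
  · rintro ⟨φ, rfl, rfl⟩
    exact ⟨φ.toSmash, rfl, rfl⟩

/-! ### Cotensors -/

/-- The levels of `E ^ L`. -/
def cotensorLvl (E : SymSpec.{u}) (L : SSet.{u}) (n : ℕ) : PSSet.{u} where
  toSSet := (ihom L).obj (E.lvl n).toSSet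
  pt _ := ihomMk (fun l _ _ => (E.lvl n).pt l) (fun η _ _ => (map_pt _ η).symm)
  map_pt _ := rfl

/-- The structure maps of `E ^ L`. -/
def cotensorSusp (E : SymSpec.{u}) (L : SSet.{u}) (k : SimplexCategoryᵒᵖ) (n : ℕ)
    (a : (cotensorLvl E L n).S k) (t : circle.{u}.S k) : (cotensorLvl E L (n + 1)).S k :=
  ihomMk (fun l θ x => E.susp l n (ihomEval a l θ x) (circle.toSSet.map θ t))
    (fun {l m} η θ x => by
      rw [Functor.map_comp_apply, ← E.susp_nat]
      exact congrArg (E.susp m n · _) (ihomEval_map a η θ x))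

theorem ihomEval_iterSusp (E : SymSpec.{u}) (L : SSet.{u}) (k : SimplexCategoryᵒᵖ) (n p : ℕ)
    (a : (cotensorLvl E L n).S k) (t : Fin p → circle.{u}.S k) (l : SimplexCategoryᵒᵖ) (θ : k ⟶ l)
    (x : L.obj l) :
    ihomEval (iterSusp (A := fun m => (cotensorLvl E L m).S k) (cotensorSusp E L k) n p a t) l θ x =
      iterSusp (A := fun m => (E.lvl m).S l) (E.susp l) n p (ihomEval a l θ x)
        (fun i => circle.toSSet.map θ (t i)) := by
  induction p with
  | zero => rfl
  | succ p ih => exact congrArg (fun y => E.susp l (n + p) y _) (ih fun i => t i.castSucc)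

/-- The symmetric spectrum `E ^ L`, with levels `Eₙ ^ L`. -/
def cotensor (E : SymSpec.{u}) (L : SSet.{u}) : SymSpec.{u} where
  lvl := cotensorLvl E L
  act n π := homMk (fun k a => ihomMk (fun l θ x => PSSet.Hom.ap (E.act n π) l (ihomEval a l θ x))
      (fun {l m} η θ x => by
        rw [← PSSet.Hom.ap_map]
        exact congrArg (PSSet.Hom.ap (E.act n π) m) (ihomEval_map a η θ x)))
    (fun _ _ => rfl) (fun k => ihom_ext fun l _ _ => PSSet.Hom.app_pt _ l)
  act_one n k a := ihom_ext fun l θ x => E.act_one n l (ihomEval a l θ x)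
  act_mul n π τ k a := ihom_ext fun l θ x => E.act_mul n π τ l (ihomEval a l θ x)
  susp := cotensorSusp E L
  susp_pt_left k n t := ihom_ext fun l θ x => E.susp_pt_left l n _
  susp_pt_right k n a := ihom_ext fun l θ x =>
    (congrArg (E.susp l n _) (circle.map_pt θ)).trans (E.susp_pt_right l n _)
  susp_nat {k l} θ n a t := ihom_ext fun m η x =>
    congrArg (E.susp m n _) (Functor.map_comp_apply circle.toSSet θ η t).symm
  susp_equivariant k n p π τ a t := ihom_ext fun l θ x => by
    refine (ihomEval_iterSusp E L k n p _ _ l θ x).trans ?_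
    refine (E.susp_equivariant l n p π τ (ihomEval a l θ x)
      (fun i => circle.toSSet.map θ (t i))).trans ?_
    exact congrArg (PSSet.Hom.ap (E.act (n + p) (blockPerm π τ)) l)
      (ihomEval_iterSusp E L k n p a t l θ x).symm

namespace ParamHom

variable {X Y E : SymSpec.{u}}

/-- The map `X ⟶ E ^ L` given by a family. -/
def toCotensor {L : SSet.{u}} (φ : ParamHom X L E) : X ⟶ E.cotensor L where
  lvl n := homMk (Y := cotensorLvl E L n)
    (fun k x => ihomMk (fun l θ a => φ.app n l ((X.lvl n).toSSet.map θ x) a)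
      (fun {l m} η θ a => by rw [Functor.map_comp_apply, φ.app_map]))
    (fun {k l} θ x => ihom_ext fun m η a =>
      congrArg (φ.app n m · a) (Functor.map_comp_apply (X.lvl n).toSSet θ η x).symm)
    (fun k => ihom_ext fun l θ a =>
      (congrArg (φ.app n l · a) (map_pt _ θ)).trans (φ.app_pt n l a))
  lvl_act n π k x := ihom_ext fun l θ a =>
    (congrArg (φ.app n l · a) (PSSet.Hom.ap_map (X.act n π) θ x).symm).trans
      (φ.app_act n π l ((X.lvl n).toSSet.map θ x) a)
  lvl_susp k n x t := ihom_ext fun l θ a =>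
    (congrArg (φ.app (n + 1) l · a) (X.susp_nat θ n x t).symm).trans
      (φ.app_susp l n ((X.lvl n).toSSet.map θ x) (circle.toSSet.map θ t) a)

/-- The family given by a map `X ⟶ E ^ L`. -/
def ofCotensor {L : SSet.{u}} (f : X ⟶ E.cotensor L) : ParamHom X L E where
  app n k x a := ihomEval (ap f n k x) k (𝟙 k) a
  app_map n k l θ x a := by
    refine (congrArg (ihomEval · l (𝟙 l) (L.map θ a)) (PSSet.Hom.ap_map (Hom.lvl f n) θ x)).trans ?_
    refine Eq.trans ?_ (ihomEval_map (ap f n k x) θ (𝟙 k) a)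
    exact congrArg (ihomEval (ap f n k x) l · (L.map θ a))
      ((Category.comp_id θ).trans (Category.id_comp θ).symm)
  app_pt n k a := congrArg (ihomEval · k (𝟙 k) a) (PSSet.Hom.app_pt (Hom.lvl f n) k)
  app_act n π k x a := congrArg (ihomEval · k (𝟙 k) a) (Hom.lvl_act f n π k x)
  app_susp k n x t a := by
    refine (congrArg (ihomEval · k (𝟙 k) a) (Hom.lvl_susp f k n x t)).trans ?_
    exact congrArg (E.susp k n _) (Functor.map_id_apply circle.toSSet k t)

theorem ofCotensor_toCotensor {L : SSet.{u}} (φ : ParamHom X L E) :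
    ofCotensor φ.toCotensor = φ :=
  ext_apply fun n k x a => congrArg (φ.app n k · a) (Functor.map_id_apply (X.lvl n).toSSet k x)

theorem toCotensor_ofCotensor {L : SSet.{u}} (f : X ⟶ E.cotensor L) :
    (ofCotensor f).toCotensor = f := by
  refine hom_ext_apply fun n k x => ihom_ext fun l θ a => ?_
  refine (congrArg (ihomEval · l (𝟙 l) a) (PSSet.Hom.ap_map (Hom.lvl f n) θ x)).trans ?_
  exact congrArg (ihomEval (ap f n k x) l · a) (Category.comp_id θ)

/-- The adjunction between `L × -` and `E ↦ E ^ L`, for families. -/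
def curry {L K : SSet.{u}} (φ : ParamHom X (L ⊗ K) E) : ParamHom X K (E.cotensor L) where
  app n k x s := ihomMk
    (fun l θ a => φ.app n l ((X.lvl n).toSSet.map θ x) (a, K.map θ s))
    (fun {l m} η θ a => by
      refine Eq.trans ?_ (φ.app_map n η ((X.lvl n).toSSet.map θ x) (a, K.map θ s))
      rw [Functor.map_comp_apply, Functor.map_comp_apply]
      rfl)
  app_map n k l θ x s := ihom_ext fun m η a => by
    exact congrArg₂ (fun y r => φ.app n m y (a, r))
      (Functor.map_comp_apply (X.lvl n).toSSet θ η x).symm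
      (Functor.map_comp_apply K θ η s).symm
  app_pt n k s := ihom_ext fun l θ a =>
    (congrArg (φ.app n l · (a, K.map θ s)) (map_pt _ θ)).trans (φ.app_pt n l _)
  app_act n π k x s := ihom_ext fun l θ a =>
    (congrArg (φ.app n l · (a, K.map θ s)) (PSSet.Hom.ap_map (X.act n π) θ x).symm).trans
      (φ.app_act n π l ((X.lvl n).toSSet.map θ x) _)
  app_susp k n x t s := ihom_ext fun l θ a =>
    (congrArg (φ.app (n + 1) l · (a, K.map θ s)) (X.susp_nat θ n x t).symm).trans
      (φ.app_susp l n ((X.lvl n).toSSet.map θ x) (circle.toSSet.map θ t) _)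

/-- The inverse of `ParamHom.curry`. -/
def uncurry {L K : SSet.{u}} (φ : ParamHom X K (E.cotensor L)) : ParamHom X (L ⊗ K) E where
  app n k x a := ihomEval (φ.app n k x a.2) k (𝟙 k) a.1
  app_map n k l θ x a := by
    refine (congrArg (ihomEval · l (𝟙 l) (L.map θ a.1)) (φ.app_map n θ x a.2)).trans ?_
    refine Eq.trans ?_ (ihomEval_map (φ.app n k x a.2) θ (𝟙 k) a.1)
    exact congrArg (ihomEval (φ.app n k x a.2) l · (L.map θ a.1))
      ((Category.comp_id θ).trans (Category.id_comp θ).symm)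
  app_pt n k a := congrArg (ihomEval · k (𝟙 k) a.1) (φ.app_pt n k a.2)
  app_act n π k x a := congrArg (ihomEval · k (𝟙 k) a.1) (φ.app_act n π k x a.2)
  app_susp k n x t a := by
    refine (congrArg (ihomEval · k (𝟙 k) a.1) (φ.app_susp k n x t a.2)).trans ?_
    exact congrArg (E.susp k n _) (Functor.map_id_apply circle.toSSet k t)

end ParamHom

/-! ### Mapping spaces -/

/-- The simplicial set of maps from `X` to `E`. -/
def mapSpace (X E : SymSpec.{u}) : SSet.{u} where
  -- The representable on `k` is Δ[k] with values in `Type`, which is why the parameter of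
  -- `ParamHom` has its own universe.
  obj k := ParamHom X (coyoneda.obj (Opposite.op k)) E
  map θ := ↾fun φ => φ.precomp (fun _ η => θ ≫ η) (fun _ _ => (Category.assoc _ _ _).symm)
  map_id k := by
    ext φ n l x η
    change φ.app n l x (𝟙 k ≫ η) = φ.app n l x η
    rw [Category.id_comp]
  map_comp θ θ' := by
    ext φ n l x η
    change φ.app n l x ((θ ≫ θ') ≫ η) = φ.app n l x (θ ≫ θ' ≫ η)
    rw [Category.assoc]

/-- The map of mapping spaces induced by `f : X ⟶ Y`. -/
def mapSpacePre {X Y : SymSpec.{u}} (f : X ⟶ Y) (E : SymSpec.{u}) : mapSpace Y E ⟶ mapSpace X E :=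
  SSet.ofFun (fun _ φ => φ.pre f) (fun _ _ => rfl)

namespace ParamHom

variable {X Y E : SymSpec.{u}}

/-- The map to the mapping space given by a family. -/
def toMapSpace {L : SSet.{u}} (φ : ParamHom X L E) : L ⟶ mapSpace X E :=
  SSet.ofFun (fun _ a => φ.precomp (fun _ θ => L.map θ a)
      (fun θ η => Functor.map_comp_apply L η θ a))
    (fun θ a => ext_apply fun n k x η =>
      congrArg (φ.app n k x) (Functor.map_comp_apply L θ η a).symm)

/-- The family given by a map to the mapping space. -/
def ofMapSpace {L : SSet.{u}} (F : L ⟶ mapSpace X E) : ParamHom X L E where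
  app n k x a := (F.app k a : ParamHom X _ E).app n k x (𝟙 k)
  app_map n k l θ x a := by
    refine (congrArg (fun φ : ParamHom X _ E => φ.app n l _ (𝟙 l))
      (NatTrans.naturality_apply F θ a)).trans ?_
    refine Eq.trans ?_ ((F.app k a : ParamHom X _ E).app_map n θ x (𝟙 k))
    exact congrArg ((F.app k a : ParamHom X _ E).app n l _)
      ((Category.comp_id θ).trans (Category.id_comp θ).symm)
  app_pt n k a := (F.app k a : ParamHom X _ E).app_pt n k _
  app_act n π k x a := (F.app k a : ParamHom X _ E).app_act n π k x _
  app_susp k n x t a := (F.app k a : ParamHom X _ E).app_susp k n x t _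

theorem ofMapSpace_toMapSpace {L : SSet.{u}} (φ : ParamHom X L E) :
    ofMapSpace φ.toMapSpace = φ :=
  ext_apply fun n k x a => congrArg (φ.app n k x) (Functor.map_id_apply L k a)

theorem toMapSpace_ofMapSpace {L : SSet.{u}} (F : L ⟶ mapSpace X E) :
    (ofMapSpace F).toMapSpace = F := by
  refine SSet.hom_ext_apply fun k a => ext_apply fun n l x θ => ?_
  refine (congrArg (fun φ : ParamHom X _ E => φ.app n l x (𝟙 l))
    (NatTrans.naturality_apply F θ a)).trans ?_
  exact congrArg ((F.app k a : ParamHom X _ E).app n l x) (Category.comp_id θ)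

theorem homotopic_toMapSpace_iff {L : SSet.{u}} {φ ψ : ParamHom X L E} :
    Homotopic φ.toMapSpace ψ.toMapSpace ↔
      ∃ Φ : ParamHom X (L ⊗ Δ1) E, Φ.res (incl 0 L) = φ ∧ Φ.res (incl 1 L) = ψ := by
  constructor
  · rintro ⟨H, h₀, h₁⟩
    refine ⟨ofMapSpace H, ?_, ?_⟩
    · exact (congrArg ofMapSpace h₀).trans (ofMapSpace_toMapSpace φ)
    · exact (congrArg ofMapSpace h₁).trans (ofMapSpace_toMapSpace ψ)
  · rintro ⟨Φ, rfl, rfl⟩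
    exact ⟨Φ.toMapSpace, rfl, rfl⟩

/-- The right-hand side is that of `homotopic_toMapSpace_iff`: homotopies of maps X → E ^ L and of
maps L → Map(X, E) are the same families over L × Δ[1]. -/
theorem homotopyRel_toCotensor_iff {L : SSet.{u}} {φ ψ : ParamHom X L E} :
    HomotopyRel φ.toCotensor ψ.toCotensor ↔
      ∃ Φ : ParamHom X (L ⊗ Δ1) E, Φ.res (incl 0 L) = φ ∧ Φ.res (incl 1 L) = ψ := by
  rw [homotopyRel_iff]
  constructor
  · rintro ⟨Ψ, h₀, h₁⟩
    refine ⟨Ψ.uncurry, ?_, ?_⟩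
    · exact (congrArg ofCotensor h₀).trans (ofCotensor_toCotensor φ)
    · exact (congrArg ofCotensor h₁).trans (ofCotensor_toCotensor ψ)
  · rintro ⟨Φ, rfl, rfl⟩
    exact ⟨Φ.curry, rfl, rfl⟩

end ParamHom

end SymSpec

/-! ### Homotopy equivalences and loop spaces -/

namespace SSet

theorem ihomEval_map_id {L Y : SSet.{u}} {k l : SimplexCategoryᵒᵖ} (a : ((ihom L).obj Y).obj k)
    (θ : k ⟶ l) (x : L.obj k) :
    ihomEval (((ihom L).obj Y).map θ a) l (𝟙 l) (L.map θ x) = Y.map θ (ihomEval a k (𝟙 k) x) :=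
  (congrArg (ihomEval a l · (L.map θ x))
    ((Category.comp_id θ).trans (Category.id_comp θ).symm)).trans (ihomEval_map a θ (𝟙 k) x)

/-- Neither `X` nor `Y` has to be Kan: the homotopies are only composed after mapping to a Kan
complex. -/
theorem isWeakEquiv_of_homotopic {X Y : SSet.{u}} (f : X ⟶ Y) (g : Y ⟶ X)
    (h₁ : Homotopic (f ≫ g) (𝟙 X)) (h₂ : Homotopic (g ≫ f) (𝟙 Y)) : IsWeakEquiv f := by
  refine (isWeakEquiv_iff f).2 fun Z hZ => ⟨fun b b' h => ?_, fun a => ⟨g ≫ a, ?_⟩⟩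
  · have h₃ := h.comp_left g
    have h₄ := h₂.comp_right b
    have h₅ := h₂.comp_right b'
    rw [Category.assoc, Category.id_comp] at h₄ h₅
    exact h₄.symm.trans (h₃.trans h₅)
  · have := h₁.comp_right a
    rwa [Category.assoc, Category.id_comp] at this

/-- A Yoneda argument: `X` and `Y` are themselves among the Kan complexes on which `f` is tested. -/
theorem IsWeakEquiv.exists_inverse {X Y : SSet.{u}} [KanComplex X] [KanComplex Y] {f : X ⟶ Y}
    (hf : IsWeakEquiv f) :
    ∃ g : Y ⟶ X, Homotopic (f ≫ g) (𝟙 X) ∧ Homotopic (g ≫ f) (𝟙 Y) := by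
  obtain ⟨g, hg⟩ := ((isWeakEquiv_iff f).1 hf X inferInstance).2 (𝟙 X)
  refine ⟨g, hg, ((isWeakEquiv_iff f).1 hf Y inferInstance).1 _ _ ?_⟩
  have := hg.comp_right f
  rwa [Category.assoc, Category.id_comp, ← Category.comp_id f, Category.assoc] at this

end SSet

namespace PSSet

open SSet Simplicial

/-- Horns are filled along the pushout-product of * → S¹ with the horn inclusion, which keeps the
filler constant on the base point. -/
theorem kanComplex_loops (Y : PSSet.{u}) [KanComplex Y.toSSet] : KanComplex (loops Y).toSSet := by
  refine kanComplex_of_exists_extension fun n i σ => ?_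
  let c : 𝟙_ SSet.{u} ⟶ circle.{u}.toSSet := SSet.ofFun (fun k _ => circle.pt k) (fun _ _ => rfl)
  have : Mono c := mono_of_injective _ fun _ _ _ _ => rfl
  let a : 𝟙_ SSet.{u} ⊗ Δ[n + 1] ⟶ Y.toSSet :=
    SSet.ofFun (fun k _ => Y.pt k) (fun θ _ => (map_pt Y θ).symm)
  let b : circle.{u}.toSSet ⊗ (Λ[n + 1, i] : SSet.{u}) ⟶ Y.toSSet :=
    SSet.ofFun (fun k x => ihomEval (σ.app k x.2).1 k (𝟙 k) x.1) (by
      rintro k l θ ⟨t, x⟩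
      refine (congrArg (fun z => ihomEval (Subtype.val z) l (𝟙 l) (circle.toSSet.map θ t))
        (NatTrans.naturality_apply σ θ x)).trans ?_
      refine Eq.trans ?_ (ihomEval_map (σ.app k x).1 θ (𝟙 k) t)
      exact congrArg (ihomEval (σ.app k x).1 l · (circle.toSSet.map θ t))
        ((Category.comp_id θ).trans (Category.id_comp θ).symm))
  obtain ⟨χ, h₁, h₂⟩ := exists_extension_pushoutProduct c (anodyneExtensions.horn_ι i) a b
    (SSet.hom_ext_apply fun k x => ((σ.app k x.2).2 k (𝟙 k)).symm)
  refine ⟨SSet.ofFun (Y := (loops Y).toSSet)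
    (fun k x => ⟨ihomMk (fun l θ t => χ.app l (t, (Δ[n + 1] : SSet.{u}).map θ x)) ?_, ?_⟩) ?_, ?_⟩
  · intro l m η θ t
    rw [Functor.map_comp_apply]
    exact NatTrans.naturality_apply χ η
      ((t, (Δ[n + 1] : SSet.{u}).map θ x) : (circle.toSSet ⊗ Δ[n + 1]).obj l)
  · intro l θ
    exact congr_apply h₁ l (PUnit.unit, (Δ[n + 1] : SSet.{u}).map θ x)
  · intro k l θ x
    refine Subtype.ext (ihom_ext fun m η t => ?_)
    exact congrArg (fun y => χ.app m (t, y))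
      (Functor.map_comp_apply (Δ[n + 1] : SSet.{u}) θ η x).symm
  · refine SSet.hom_ext_apply fun k x => Subtype.ext (ihom_ext fun l θ t => ?_)
    refine (congr_apply h₂ l (t, (Λ[n + 1, i] : SSet.{u}).map θ x)).trans ?_
    refine (congrArg (fun z => ihomEval (Subtype.val z) l (𝟙 l) t)
      (NatTrans.naturality_apply σ θ x)).trans ?_
    exact congrArg (ihomEval (σ.app k x).1 l · t) (Category.comp_id θ)

end PSSet

/-! ### Cotensors of injective Ω-spectra -/

namespace SymSpec

open PSSet SSet Simplicial

/-- By adjunction, extending a map to E ^ L along `i` is extending a map to E along `i` ∧ L₊, which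
is again an injective level equivalence. -/
theorem IsInjective.cotensor {E : SymSpec.{u}} (hE : E.IsInjective) (L : SSet.{u}) :
    (E.cotensor L).IsInjective := by
  intro A B i hi hi' f
  obtain ⟨g, hg⟩ := hE _ _ (smashMap i (plus L))
    (fun n k => smash_map_plus_injective _ L k (hi n k))
    (fun n => isWeakEquiv_smash_map_plus _ (hi n) (hi' n) L) (ParamHom.ofCotensor f).toSmash
  refine ⟨(ParamHom.ofSmash g).toCotensor, ?_⟩
  rw [← ParamHom.toCotensor_ofCotensor f, ← ParamHom.ofSmash_toSmash (ParamHom.ofCotensor f), ← hg]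
  refine hom_ext_apply fun n k x => ihom_ext fun l θ a => ?_
  exact congrArg (fun y => ap g n l (smash.mkPlus y a)) (PSSet.Hom.ap_map (Hom.lvl i n) θ x).symm

/-- A simplex of `Map_*(S¹, Y ^ L)` gives a family of simplices of `Map_*(S¹, Y)`. -/
def loopsEval {E : SymSpec.{u}} {L : SSet.{u}} {n : ℕ} {k : SimplexCategoryᵒᵖ}
    (b : (loops (cotensorLvl E L n)).toSSet.obj k) (l : SimplexCategoryᵒᵖ) (θ : k ⟶ l)
    (x : L.obj l) : (loops (E.lvl n)).toSSet.obj l :=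
  ⟨ihomMk (fun m η t => ihomEval (Y := (E.lvl n).toSSet) (ihomEval b.1 m (θ ≫ η) t) m (𝟙 m)
      (L.map η x))
    (fun {m m'} η ξ t => by
      rw [Functor.map_comp_apply]
      refine Eq.trans ?_ (ihomEval_map_id (Y := (E.lvl n).toSSet) (ihomEval b.1 m (θ ≫ ξ) t) η
        (L.map ξ x))
      refine congrArg (ihomEval (Y := (E.lvl n).toSSet) · m' (𝟙 m') (L.map η (L.map ξ x))) ?_
      refine Eq.trans ?_ (ihomEval_map b.1 η (θ ≫ ξ) t)
      rw [Category.assoc]),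
    fun m η => congrArg (ihomEval (Y := (E.lvl n).toSSet) · m (𝟙 m) (L.map η x))
      (b.2 m (θ ≫ η))⟩

theorem loopsEval_map {E : SymSpec.{u}} {L : SSet.{u}} {n : ℕ} {k : SimplexCategoryᵒᵖ}
    (b : (loops (cotensorLvl E L n)).toSSet.obj k) {l m : SimplexCategoryᵒᵖ} (η : l ⟶ m)
    (θ : k ⟶ l) (x : L.obj l) :
    loopsEval b m (θ ≫ η) (L.map η x) = (loops (E.lvl n)).toSSet.map η (loopsEval b l θ x) := by
  refine Subtype.ext (ihom_ext fun m' ξ t => ?_)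
  change ihomEval (Y := (E.lvl n).toSSet) (ihomEval b.1 m' ((θ ≫ η) ≫ ξ) t) m' (𝟙 m')
    (L.map ξ (L.map η x)) = ihomEval (Y := (E.lvl n).toSSet) (ihomEval b.1 m' (θ ≫ η ≫ ξ) t) m'
      (𝟙 m') (L.map (η ≫ ξ) x)
  rw [Category.assoc, Functor.map_comp_apply]

theorem loopsEval_map_left {E : SymSpec.{u}} {L : SSet.{u}} {n : ℕ} {k l : SimplexCategoryᵒᵖ}
    (b : (loops (cotensorLvl E L n)).toSSet.obj k) (θ : k ⟶ l) (m : SimplexCategoryᵒᵖ)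
    (η : l ⟶ m) (x : L.obj m) :
    loopsEval b m (θ ≫ η) x = loopsEval ((loops (cotensorLvl E L n)).toSSet.map θ b) m η x := by
  refine Subtype.ext (ihom_ext fun m' ξ t => ?_)
  change ihomEval (Y := (E.lvl n).toSSet) (ihomEval b.1 m' ((θ ≫ η) ≫ ξ) t) m' (𝟙 m')
    (L.map ξ x) = ihomEval (Y := (E.lvl n).toSSet) (ihomEval b.1 m' (θ ≫ η ≫ ξ) t) m' (𝟙 m')
      (L.map ξ x)
  rw [Category.assoc]

theorem loopsEval_eval {E : SymSpec.{u}} {L : SSet.{u}} {n : ℕ} {k : SimplexCategoryᵒᵖ}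
    (b : (loops (cotensorLvl E L n)).toSSet.obj k) {l m : SimplexCategoryᵒᵖ} (η : l ⟶ m)
    (θ : k ⟶ l) (x : L.obj m) (t : circle.{u}.S l) :
    ihomEval (loopsEval b m (θ ≫ η) x).1 m (𝟙 m) (circle.toSSet.map η t) =
      ihomEval (Y := (E.lvl n).toSSet) (ihomEval b.1 l θ t) m η x := by
  change ihomEval (Y := (E.lvl n).toSSet)
    (ihomEval b.1 m ((θ ≫ η) ≫ 𝟙 m) (circle.toSSet.map η t)) m (𝟙 m) (L.map (𝟙 m) x) = _
  rw [Category.comp_id, Functor.map_id_apply]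
  refine (congrArg (ihomEval (Y := (E.lvl n).toSSet) · m (𝟙 m) x)
    (ihomEval_map b.1 η θ t)).trans ?_
  exact congrArg (ihomEval (Y := (E.lvl n).toSSet) (ihomEval b.1 l θ t) m · x) (Category.comp_id η)

/-- Under the exchange of S¹ and L in a mapping space, the adjoint structure map of E ^ L is that of
E applied pointwise over L. -/
theorem loopsEval_adjSusp (E : SymSpec.{u}) (L : SSet.{u}) (n : ℕ) {k : SimplexCategoryᵒᵖ}
    (a : (cotensorLvl E L n).S k) (l : SimplexCategoryᵒᵖ) (θ : k ⟶ l) (x : L.obj l) :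
    loopsEval (((E.cotensor L).adjSusp n).app k a) l θ x =
      (E.adjSusp n).app l (ihomEval a l θ x) := by
  refine Subtype.ext (ihom_ext fun m η t => ?_)
  change E.susp m n (ihomEval a m ((θ ≫ η) ≫ 𝟙 m) (L.map η x)) (circle.toSSet.map (𝟙 m) t) =
    E.susp m n ((E.lvl n).toSSet.map η (ihomEval a l θ x)) t
  rw [Category.comp_id, Functor.map_id_apply]
  exact congrArg (E.susp m n · t) (ihomEval_map a η θ x)

/-- The functor (-) ^ L carries the inverse and both homotopies along pointwise. This is why an
explicit homotopy inverse is assumed instead of a weak equivalence. -/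
theorem isWeakEquiv_adjSusp_cotensor (E : SymSpec.{u}) (L : SSet.{u}) (n : ℕ)
    (g : (loops (E.lvl (n + 1))).toSSet ⟶ (E.lvl n).toSSet)
    (h₁ : Homotopic (E.adjSusp n ≫ g) (𝟙 _)) (h₂ : Homotopic (g ≫ E.adjSusp n) (𝟙 _)) :
    IsWeakEquiv ((E.cotensor L).adjSusp n) := by
  obtain ⟨H, hH₀, hH₁⟩ := h₁
  obtain ⟨K, hK₀, hK₁⟩ := h₂
  let g' : (loops (cotensorLvl E L (n + 1))).toSSet ⟶ (cotensorLvl E L n).toSSet :=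
    SSet.ofFun (Y := (ihom L).obj (E.lvl n).toSSet)
      (fun k b => ihomMk (fun l θ x => g.app l (loopsEval b l θ x))
        (fun {l m} η θ x => by
          rw [loopsEval_map]
          exact NatTrans.naturality_apply g η (loopsEval b l θ x)))
      (fun _ _ => rfl)
  refine isWeakEquiv_of_homotopic _ g' ⟨?_, ?_, ?_⟩ ⟨?_, ?_, ?_⟩
  · exact SSet.ofFun (X := (ihom L).obj (E.lvl n).toSSet ⊗ Δ1) (Y := (ihom L).obj (E.lvl n).toSSet)
      (fun k b => ihomMk (fun l θ x => H.app l (ihomEval b.1 l θ x, Δ1.map θ b.2))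
        (fun {l m} η θ x => by
          rw [ihomEval_map, Functor.map_comp_apply]
          exact NatTrans.naturality_apply H η
            ((ihomEval b.1 l θ x, Δ1.map θ b.2) : ((E.lvl n).toSSet ⊗ Δ1).obj l)))
      (fun {k l} θ b => ihom_ext fun m η x =>
        congrArg (fun s => H.app m (ihomEval b.1 m (θ ≫ η) x, s))
          (Functor.map_comp_apply Δ1 θ η b.2).symm)
  · refine SSet.hom_ext_apply fun k a => ihom_ext fun l θ x => ?_
    refine (congr_apply hH₀ l (ihomEval a l θ x)).trans ?_
    exact congrArg (g.app l) (loopsEval_adjSusp E L n a l θ x).symm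
  · refine SSet.hom_ext_apply fun k a => ihom_ext fun l θ x => ?_
    exact congr_apply hH₁ l (ihomEval a l θ x)
  · refine SSet.ofFun (X := (loops (cotensorLvl E L (n + 1))).toSSet ⊗ Δ1)
      (Y := (loops (cotensorLvl E L (n + 1))).toSSet)
      (fun k b => ⟨ihomMk (Y := (cotensorLvl E L (n + 1)).toSSet) (fun m ξ t =>
          ihomMk (Y := (E.lvl (n + 1)).toSSet) (fun l η x =>
            ihomEval (K.app l (loopsEval b.1 l (ξ ≫ η) x, Δ1.map (ξ ≫ η) b.2)).1 l (𝟙 l)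
              (circle.toSSet.map η t)) ?_) ?_, ?_⟩) ?_
    · intro l l' η η' x
      have e := loopsEval_map b.1 η (ξ ≫ η') x
      rw [Category.assoc] at e
      rw [e, Functor.map_comp_apply circle.toSSet, ← Category.assoc, Functor.map_comp_apply Δ1]
      refine Eq.trans ?_ (ihomEval_map_id (Y := (E.lvl (n + 1)).toSSet) _ η
        (circle.toSSet.map η' t))
      exact congrArg (fun z => ihomEval (Subtype.val z) l' (𝟙 l')
          (circle.toSSet.map η (circle.toSSet.map η' t)))
        (NatTrans.naturality_apply K η ((loopsEval b.1 l (ξ ≫ η') x, Δ1.map (ξ ≫ η') b.2) :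
          ((loops (E.lvl (n + 1))).toSSet ⊗ Δ1).obj l))
    · intro l m η ξ t
      refine ihom_ext fun l' η' x => ?_
      change ihomEval (K.app l' (loopsEval b.1 l' ((ξ ≫ η) ≫ η') x, Δ1.map ((ξ ≫ η) ≫ η') b.2)).1
        l' (𝟙 l') (circle.toSSet.map η' (circle.toSSet.map η t)) =
        ihomEval (K.app l' (loopsEval b.1 l' (ξ ≫ η ≫ η') x, Δ1.map (ξ ≫ η ≫ η') b.2)).1
        l' (𝟙 l') (circle.toSSet.map (η ≫ η') t)
      rw [Category.assoc, Functor.map_comp_apply circle.toSSet]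
    · intro l θ
      refine ihom_ext fun l' η' x => ?_
      let D := K.app l' (loopsEval b.1 l' (θ ≫ η') x, Δ1.map (θ ≫ η') b.2)
      exact (congrArg (fun t => ihomEval D.1 l' (𝟙 l') t) (circle.map_pt η')).trans (D.2 l' (𝟙 l'))
    · intro k l θ b
      refine Subtype.ext (ihom_ext fun m η t => ihom_ext fun l' η' x => ?_)
      let D (y : (loops (E.lvl (n + 1))).toSSet.obj l') (s : Δ1.obj l') :=
        ihomEval (K.app l' (y, s)).1 l' (𝟙 l') (circle.toSSet.map η' t)
      have e : loopsEval b.1 l' ((θ ≫ η) ≫ η') x = loopsEval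
          ((loops (cotensorLvl E L (n + 1))).toSSet.map θ b.1) l' (η ≫ η') x := by
        rw [Category.assoc]
        exact loopsEval_map_left b.1 θ l' (η ≫ η') x
      exact congrArg₂ D e.symm ((Functor.map_comp_apply Δ1 θ (η ≫ η') b.2).symm.trans
        (congrArg (Δ1.map · b.2) (Category.assoc θ η η').symm))
  · refine SSet.hom_ext_apply fun k b =>
      Subtype.ext (ihom_ext fun m ξ t => ihom_ext fun l η x => ?_)
    refine (congrArg (fun z => ihomEval (Subtype.val z) l (𝟙 l) (circle.toSSet.map η t))
      (congr_apply hK₀ l (loopsEval b l (ξ ≫ η) x))).trans ?_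
    exact congrArg (E.susp l n · (circle.toSSet.map η t))
      (Functor.map_id_apply (E.lvl n).toSSet l _)
  · refine SSet.hom_ext_apply fun k b =>
      Subtype.ext (ihom_ext fun m ξ t => ihom_ext fun l η x => ?_)
    refine (congrArg (fun z => ihomEval (Subtype.val z) l (𝟙 l) (circle.toSSet.map η t))
      (congr_apply hK₁ l (loopsEval b l (ξ ≫ η) x))).trans ?_
    exact loopsEval_eval b η ξ x t

theorem IsOmega.cotensor {E : SymSpec.{u}} (hE : E.IsOmega) (L : SSet.{u}) :
    (E.cotensor L).IsOmega := by
  intro n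
  have := (hE n).1
  have := (hE (n + 1)).1
  have := kanComplex_loops (E.lvl (n + 1))
  obtain ⟨g, h₁, h₂⟩ := (hE n).2.exists_inverse
  exact ⟨inferInstanceAs (KanComplex ((ihom L).obj (E.lvl n).toSSet)),
    isWeakEquiv_adjSusp_cotensor E L n g h₁ h₂⟩

end SymSpec

/-! ### Two out of three, trivial fibrations and right properness -/

namespace SSet

open Simplicial HomotopicalAlgebra Limits CartesianMonoidalCategory modelCategoryQuillen

theorem HoClass.precomp_comp {X Y Z : SSet.{u}} (f : X ⟶ Y) (g : Y ⟶ Z) (T : SSet.{u}) :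
    HoClass.precomp (f ≫ g) T = HoClass.precomp f T ∘ HoClass.precomp g T := by
  funext a
  obtain ⟨a, rfl⟩ := Quot.exists_rep a
  exact congrArg (Quot.mk _) (Category.assoc f g a)

theorem IsWeakEquiv.comp {X Y Z : SSet.{u}} {f : X ⟶ Y} {g : Y ⟶ Z} (hf : IsWeakEquiv f)
    (hg : IsWeakEquiv g) : IsWeakEquiv (f ≫ g) := fun T hT => by
  rw [HoClass.precomp_comp]
  exact (hf T hT).comp (hg T hT)

theorem IsWeakEquiv.of_comp_left {X Y Z : SSet.{u}} {f : X ⟶ Y} {g : Y ⟶ Z} (hf : IsWeakEquiv f)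
    (h : IsWeakEquiv (f ≫ g)) : IsWeakEquiv g := fun T hT => by
  have h := h T hT
  rw [HoClass.precomp_comp] at h
  exact (Function.Bijective.of_comp_iff' (hf T hT) _).1 h

theorem IsWeakEquiv.of_comp_right {X Y Z : SSet.{u}} {f : X ⟶ Y} {g : Y ⟶ Z} (hg : IsWeakEquiv g)
    (h : IsWeakEquiv (f ≫ g)) : IsWeakEquiv f := fun T hT => by
  have h := h T hT
  rw [HoClass.precomp_comp] at h
  exact (Function.Bijective.of_comp_iff _ (hg T hT)).1 h

theorem IsWeakEquiv.rlp_monomorphisms {X Y : SSet.{u}} [KanComplex X] [KanComplex Y] {p : X ⟶ Y}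
    [Fibration p] (hp : IsWeakEquiv p) : (MorphismProperty.monomorphisms SSet.{u}).rlp p := by
  obtain ⟨g, h₁, h₂⟩ := hp.exists_inverse
  intro K L i hi
  have : Mono i := hi
  refine ⟨fun {a b} sq => ?_⟩
  obtain ⟨c, hc₁, hc₂⟩ := rlp_monomorphisms_of_fibration p
    (fun f => ⟨f ≫ g, by simpa using h₂.comp_left f⟩)
    (fun f f' h => by
      have h' := h.comp_right g
      simp only [Category.assoc] at h'
      have e := h₁.comp_left f
      have e' := h₁.comp_left f'
      rw [Category.comp_id] at e e'
      exact e.symm.trans (h'.trans e')) i a b sq.w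
  exact ⟨⟨⟨c, hc₁, hc₂⟩⟩⟩

/-- Lifting against the empty subobject of Y gives a section `q`, and lifting against X × ∂Δ[1] → X
× Δ[1] gives a homotopy from `p ≫ q` to the identity. -/
theorem isWeakEquiv_of_rlp_monomorphisms {X Y : SSet.{u}} {p : X ⟶ Y}
    (hp : (MorphismProperty.monomorphisms SSet.{u}).rlp p) : IsWeakEquiv p := by
  have lift : ∀ {K L : SSet.{u}} (i : K ⟶ L) [Mono i] (a : K ⟶ X) (b : L ⟶ Y), a ≫ p = i ≫ b →
      ∃ c : L ⟶ X, i ≫ c = a ∧ c ≫ p = b := fun i _ a b h => by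
    have := hp i ‹_›
    have sq : CommSq a i p b := ⟨h⟩
    exact ⟨sq.lift, sq.fac_left, sq.fac_right⟩
  obtain ⟨q, -, hq⟩ := lift (⊥ : Y.Subcomplex).ι
    (SSet.ofFun (fun _ x => x.2.elim) (fun _ x => x.2.elim)) (𝟙 Y)
    (SSet.hom_ext_apply fun _ x => x.2.elim)
  have := mono_whiskerLeft (boundary.{u} 1).ι X
  obtain ⟨H, hH, -⟩ := lift (X ◁ (boundary.{u} 1).ι) (boundaryDesc ![p ≫ q, 𝟙 X]) (fst _ _ ≫ p) (by
    refine SSet.hom_ext_apply fun k => ?_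
    rintro ⟨x, ⟨s, hs⟩⟩
    obtain ⟨ε, rfl⟩ := mem_boundary_one.1 hs
    fin_cases ε
    · exact congr_apply hq k (p.app k x)
    · rfl)
  rw [whiskerLeft_boundary_comp_eq_iff] at hH
  refine isWeakEquiv_of_homotopic p q ⟨H, hH 0, hH 1⟩ ?_
  rw [hq]
  exact .refl _

/-- The pullback of an anodyne extension between Kan complexes along a fibration is a weak
equivalence. -/
theorem isWeakEquiv_of_isPullback_anodyneExtensions {V X Y P : SSet.{u}} [KanComplex Y]
    {v : V ⟶ X} {v' : V ⟶ Y} {p : X ⟶ P} {i : Y ⟶ P} [KanComplex P] [Fibration p]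
    (hi : anodyneExtensions i) (sq : IsPullback v v' p i) : IsWeakEquiv v := by
  obtain ⟨r, hr⟩ : ∃ r : P ⟶ Y, i ≫ r = 𝟙 Y := by
    have := hi (terminal.from Y) (by have := fibration_terminal Y; exact mem_fibrations _)
    have sq : CommSq (𝟙 Y) i (terminal.from Y) (terminal.from P) := ⟨by subsingleton⟩
    exact ⟨sq.lift, sq.fac_left⟩
  have : IsSplitMono i := ⟨⟨⟨r, hr⟩⟩⟩
  have hv : Mono v := MorphismProperty.of_isPullback sq.flip
    (MorphismProperty.monomorphisms.infer_property i)
  -- Since `P` is Kan and `i` is anodyne, `r` is the retraction of a deformation of `P` onto `Y`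
  -- that fixes `Y`.
  obtain ⟨R, hR, hR'⟩ : ∃ R : P ⊗ Δ[1] ⟶ P, i ▷ _ ≫ R = fst _ _ ≫ i ∧
      P ◁ (boundary.{u} 1).ι ≫ R = boundaryDesc ![r ≫ i, 𝟙 P] := by
    refine hi.isWeakEquiv.exists_extension (boundary.{u} 1).ι (fst _ _ ≫ i) _ ?_
    refine SSet.hom_ext_apply fun k => ?_
    rintro ⟨x, ⟨s, hs⟩⟩
    obtain ⟨ε, rfl⟩ := mem_boundary_one.1 hs
    fin_cases ε
    · exact (congrArg (i.app k) (congr_apply hr k x)).symm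
    · rfl
  rw [whiskerLeft_boundary_comp_eq_iff] at hR'
  -- Lift the deformation to `X`, starting at the identity and staying constant on `V`. Its other
  -- end lies over `Y`, so it factors through the pullback `V` and gives a homotopy inverse of `v`.
  obtain ⟨H, hH₁, hH₂, hH₃⟩ := exists_homotopy_lift 1 v p (𝟙 X) (fst _ _ ≫ v) (p ▷ _ ≫ R) rfl
    (by
      have h := congrArg (v' ▷ Δ[1] ≫ ·) hR
      have e : v' ▷ Δ[1] ≫ i ▷ Δ[1] = v ▷ Δ[1] ≫ p ▷ Δ[1] := by
        rw [← comp_whiskerRight, ← comp_whiskerRight, sq.w]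
      simp only [reassoc_of% e] at h
      rw [h, Category.assoc, sq.w]
      rfl)
    (by
      rw [Category.id_comp]
      exact congrArg (p ≫ ·) (hR' 1))
  have e₀ : (incl 0 X ≫ H) ≫ p = (p ≫ r) ≫ i := by
    rw [Category.assoc, hH₃, Category.assoc]
    exact congrArg (p ≫ ·) (hR' 0)
  refine isWeakEquiv_of_homotopic v (sq.lift _ _ e₀) ?_ ?_
  · have : v ≫ sq.lift _ _ e₀ = 𝟙 V := by
      rw [← cancel_mono v, Category.assoc, sq.lift_fst, Category.id_comp]
      exact congrArg (incl 0 V ≫ ·) hH₁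
    rw [this]
    exact .refl _
  · rw [sq.lift_fst]
    exact ⟨H, rfl, hH₂⟩

/-- The pullback of a weak equivalence between Kan complexes along a fibration is a weak
equivalence. -/
theorem isWeakEquiv_of_isPullback {V X Y' Y : SSet.{u}} [KanComplex X] [KanComplex Y']
    [KanComplex Y] {v : V ⟶ X} {v' : V ⟶ Y'} {p : X ⟶ Y} {b : Y' ⟶ Y} [Fibration p]
    (hb : IsWeakEquiv b) (sq : IsPullback v v' p b) : IsWeakEquiv v := by
  -- Factor `b` as an anodyne extension followed by a fibration. By cancellation the second factor
  -- is a trivial fibration, whose base changes are weak equivalences; the first factor is the case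
  -- already treated.
  let F := MorphismProperty.factorizationData J.{u}.rlp.llp J.{u}.rlp b
  have hi : anodyneExtensions F.i := F.hi
  have : Fibration F.p := (modelCategoryQuillen.fibration_iff _).2 F.hp
  have : KanComplex F.Z := isFibrant_of_fibration F.p
  have hp : IsWeakEquiv F.p := hi.isWeakEquiv.of_comp_left (by rw [F.fac]; exact hb)
  have sq' := IsPullback.of_hasPullback p F.p
  have hq : IsWeakEquiv (pullback.fst p F.p) := isWeakEquiv_of_rlp_monomorphisms
    (MorphismProperty.of_isPullback sq'.flip hp.rlp_monomorphisms)
  have : Fibration (pullback.snd p F.p) := (modelCategoryQuillen.fibration_iff _).2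
    (MorphismProperty.of_isPullback sq' ((modelCategoryQuillen.fibration_iff p).1 inferInstance))
  have sq'' := IsPullback.of_right' (h₂₁ := F.i) (h₂₂ := F.p) (by rwa [F.fac]) sq'
  have := (isWeakEquiv_of_isPullback_anodyneExtensions hi sq'').comp hq
  rwa [sq'.lift_fst] at this

end SSet

/-! ### Fibrations of mapping spaces -/

namespace SSet

open MorphismProperty in
theorem anodyneExtensions_le_monomorphisms :
    anodyneExtensions.{u} ≤ monomorphisms SSet.{u} := by
  rw [anodyneExtensions_eq_retracts_transfiniteCompositions, retracts_le_iff,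
    transfiniteCompositions_le_iff, pushouts_le_iff, coproducts_le_iff]
  exact modelCategoryQuillen.J_le_monomorphisms

end SSet

namespace SymSpec

open PSSet SSet Simplicial HomotopicalAlgebra modelCategoryQuillen

/-- The map `X ∧ f`. -/
def smashMapRight (X : SymSpec.{u}) {K K' : PSSet.{u}} (f : K ⟶ K') : X.smash K ⟶ X.smash K' where
  lvl n := PSSet.smash.mapRight (X.lvl n) f
  lvl_act := by
    rintro n π k ⟨x, a⟩
    rfl
  lvl_susp := by
    rintro k n ⟨x, a⟩ t
    rfl

/-- The pushout-product of `i` and `j₊` is levelwise anodyne, hence an injective level equivalence,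
and E extends maps along it. -/
theorem IsInjective.exists_extension {E : SymSpec.{u}} (hE : E.IsInjective) {A B : SymSpec.{u}}
    (i : A ⟶ B) (hi : ∀ n k, Function.Injective (ap i n k)) {K L : SSet.{u}} {j : K ⟶ L}
    (hj : anodyneExtensions j) (φ : ParamHom A L E) (ψ : ParamHom B K E)
    (h : φ.res j = ψ.pre i) : ∃ χ : ParamHom B L E, χ.pre i = φ ∧ χ.res j = ψ := by
  have w : A.smashMapRight (plusMap j) ≫ smashMap i (plus L) =
      smashMap i (plus K) ≫ B.smashMapRight (plusMap j) := smashPlus_hom_ext fun _ _ _ _ => rfl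
  have hd (n : ℕ) : anodyneExtensions (PSSet.Hom.hom (Hom.lvl (glue.desc _ _ w) n)) :=
    anodyneExtensions_glue_desc_smash (Hom.lvl i n) (hi n) hj
      fun k a => congrArg (fun r => ap r n k a) w
  obtain ⟨χ, hχ⟩ := hE _ _ (glue.desc _ _ w)
    (fun n k => by
      have : Mono _ := anodyneExtensions_le_monomorphisms _ (hd n)
      exact injective_of_mono _ k)
    (fun n => (hd n).isWeakEquiv)
    (glue.desc φ.toSmash ψ.toSmash (smashPlus_hom_ext fun n k x a => ParamHom.congr_app h n k x a))
  refine ⟨.ofSmash χ, ParamHom.ext_apply fun n k x a => ?_, ParamHom.ext_apply fun n k x a => ?_⟩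
  · exact congr_ap hχ n k (ap (glue.inl _ _) n k (smash.mkPlus x a))
  · exact congr_ap hχ n k (ap (glue.inr _ _) n k (smash.mkPlus x a))

/-- Restriction along a levelwise injective map is a fibration of mapping spaces. -/
theorem IsInjective.fibration_mapSpacePre {E : SymSpec.{u}} (hE : E.IsInjective)
    {A B : SymSpec.{u}} (i : A ⟶ B) (hi : ∀ n k, Function.Injective (ap i n k)) :
    Fibration (mapSpacePre i E) := by
  refine fibration_of_exists_lift _ fun n m σ τ h => ?_
  obtain ⟨χ, h₁, h₂⟩ := hE.exists_extension i hi (anodyneExtensions.horn_ι m)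
    (ParamHom.ofMapSpace τ) (ParamHom.ofMapSpace σ) (congrArg ParamHom.ofMapSpace h).symm
  refine ⟨χ.toMapSpace, ?_, ?_⟩
  · exact (congrArg ParamHom.toMapSpace h₂).trans (ParamHom.toMapSpace_ofMapSpace σ)
  · exact (congrArg ParamHom.toMapSpace h₁).trans (ParamHom.toMapSpace_ofMapSpace τ)

/-- This is horn extension relative to * → X, where every family is already determined. -/
theorem IsInjective.kanComplex_mapSpace {E : SymSpec.{u}} (hE : E.IsInjective) (X : SymSpec.{u}) :
    KanComplex (mapSpace X E) := by
  refine kanComplex_of_exists_extension fun n m σ => ?_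
  obtain ⟨χ, -, h⟩ := hE.exists_extension (fromPoint X) (fun _ _ _ _ _ => rfl)
    (anodyneExtensions.horn_ι m) (ParamHom.const _ (fromPoint E)) (ParamHom.ofMapSpace σ)
    (ParamHom.ext_apply fun n k x a => ((ParamHom.ofMapSpace σ).app_pt n k a).symm)
  exact ⟨χ.toMapSpace, (congrArg ParamHom.toMapSpace h).trans (ParamHom.toMapSpace_ofMapSpace σ)⟩

/-! ### Stable equivalences and mapping spaces -/

theorem homotopic_of_mk_eq {E X : SymSpec.{u}} (hE : E.IsInjective) {L : SSet.{u}}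
    {φ ψ : ParamHom X L E}
    (h : (Quot.mk _ φ.toCotensor : E0 (E.cotensor L) X) = Quot.mk _ ψ.toCotensor) :
    Homotopic φ.toMapSpace ψ.toMapSpace := by
  have := hE.kanComplex_mapSpace X
  have key : ∀ f g : X ⟶ E.cotensor L, Relation.EqvGen HomotopyRel f g →
      Homotopic (ParamHom.ofCotensor f).toMapSpace (ParamHom.ofCotensor g).toMapSpace := by
    intro f g h
    induction h with
    | rel f g h =>
      rw [← ParamHom.toCotensor_ofCotensor f, ← ParamHom.toCotensor_ofCotensor g,
        ParamHom.homotopyRel_toCotensor_iff] at h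
      exact ParamHom.homotopic_toMapSpace_iff.2 h
    | refl _ => exact .refl _
    | symm _ _ _ ih => exact ih.symm
    | trans _ _ _ _ _ ih₁ ih₂ => exact ih₁.trans ih₂
  have := key _ _ (Quot.eqvGen_exact h)
  rwa [ParamHom.ofCotensor_toCotensor, ParamHom.ofCotensor_toCotensor] at this

theorem mk_eq_of_homotopic {E X : SymSpec.{u}} {L : SSet.{u}} {φ ψ : ParamHom X L E}
    (h : Homotopic φ.toMapSpace ψ.toMapSpace) :
    (Quot.mk _ φ.toCotensor : E0 (E.cotensor L) X) = Quot.mk _ ψ.toCotensor :=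
  Quot.sound (ParamHom.homotopyRel_toCotensor_iff.2 (ParamHom.homotopic_toMapSpace_iff.1 h))

theorem ParamHom.pre_toCotensor {X Y E : SymSpec.{u}} {L : SSet.{u}} (f : X ⟶ Y)
    (φ : ParamHom Y L E) : (φ.pre f).toCotensor = f ≫ φ.toCotensor :=
  hom_ext_apply fun n _ x => ihom_ext fun l θ a =>
    congrArg (φ.app n l · a) (PSSet.Hom.ap_map (Hom.lvl f n) θ x)

/-- Testing `f` on all the cotensors E ^ L makes Map(f, E) bijective on homotopy classes of maps out
of every L. Taking L to be Map(X, E) produces a homotopy inverse. -/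
theorem IsStableEquiv.isWeakEquiv_mapSpacePre {X Y : SymSpec.{u}} {f : X ⟶ Y}
    (hf : IsStableEquiv f) {E : SymSpec.{u}} (hE : E.IsInjective) (hE' : E.IsOmega) :
    IsWeakEquiv (mapSpacePre f E) := by
  have := hE.kanComplex_mapSpace X
  have := hE.kanComplex_mapSpace Y
  have surj : ∀ {L : SSet.{u}} (F : L ⟶ mapSpace X E), ∃ G : L ⟶ mapSpace Y E,
      Homotopic (G ≫ mapSpacePre f E) F := fun {L} F => by
    obtain ⟨g, hg⟩ := (hf _ (hE.cotensor L) (hE'.cotensor L)).2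
      (Quot.mk _ (ParamHom.ofMapSpace F).toCotensor)
    obtain ⟨g, rfl⟩ := Quot.exists_rep g
    refine ⟨(ParamHom.ofCotensor g).toMapSpace, ?_⟩
    have := homotopic_of_mk_eq (φ := (ParamHom.ofCotensor g).pre f) hE (Eq.trans
      (congrArg (Quot.mk _) (by rw [ParamHom.pre_toCotensor, ParamHom.toCotensor_ofCotensor])) hg)
    rwa [ParamHom.toMapSpace_ofMapSpace] at this
  have inj : ∀ {L : SSet.{u}} (F G : L ⟶ mapSpace Y E),
      Homotopic (F ≫ mapSpacePre f E) (G ≫ mapSpacePre f E) → Homotopic F G := fun {L} F G h => by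
    rw [← ParamHom.toMapSpace_ofMapSpace F, ← ParamHom.toMapSpace_ofMapSpace G] at h ⊢
    have h' := mk_eq_of_homotopic (φ := (ParamHom.ofMapSpace F).pre f)
      (ψ := (ParamHom.ofMapSpace G).pre f) h
    rw [ParamHom.pre_toCotensor, ParamHom.pre_toCotensor] at h'
    exact homotopic_of_mk_eq hE ((hf _ (hE.cotensor L) (hE'.cotensor L)).1
      (a₁ := Quot.mk _ _) (a₂ := Quot.mk _ _) h')
  obtain ⟨g, hg⟩ := surj (𝟙 _)
  refine isWeakEquiv_of_homotopic _ g (inj _ _ ?_) hg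
  simpa using hg.comp_left (mapSpacePre f E)

theorem homotopyRel_iff_homotopic {X E : SymSpec.{u}} {f g : X ⟶ E} :
    HomotopyRel f g ↔ Homotopic (ParamHom.const (𝟙_ SSet.{u}) f).toMapSpace
      (ParamHom.const (𝟙_ SSet.{u}) g).toMapSpace := by
  rw [homotopyRel_iff, ParamHom.homotopic_toMapSpace_iff]
  constructor
  · rintro ⟨φ, rfl, rfl⟩
    exact ⟨φ.res (CartesianMonoidalCategory.snd _ _), rfl, rfl⟩
  · rintro ⟨Φ, h₀, h₁⟩
    refine ⟨Φ.precomp (fun k s => (PUnit.unit, s)) (fun _ _ => rfl), ?_, ?_⟩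
    · exact hom_ext_apply fun n k x => ParamHom.congr_app h₀ n k x PUnit.unit
    · exact hom_ext_apply fun n k x => ParamHom.congr_app h₁ n k x PUnit.unit

theorem exists_const_toMapSpace_eq {X E : SymSpec.{u}} (F : 𝟙_ SSet.{u} ⟶ mapSpace X E) :
    ∃ f : X ⟶ E, (ParamHom.const (𝟙_ SSet.{u}) f).toMapSpace = F :=
  ⟨(ParamHom.ofMapSpace F).eval (fun _ => PUnit.unit) (fun _ => rfl),
    ParamHom.toMapSpace_ofMapSpace F⟩

/-- E⁰(X) is the set of homotopy classes of maps * → Map(X, E), and a weak equivalence of Kan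
complexes has a homotopy inverse. -/
theorem isStableEquiv_of_isWeakEquiv_mapSpacePre {X Y : SymSpec.{u}} {f : X ⟶ Y}
    (hf : ∀ E : SymSpec.{u}, E.IsInjective → E.IsOmega → IsWeakEquiv (mapSpacePre f E)) :
    IsStableEquiv f := by
  intro E hE hE'
  have := hE.kanComplex_mapSpace X
  have := hE.kanComplex_mapSpace Y
  obtain ⟨G, h₁, h₂⟩ := (hf E hE hE').exists_inverse
  constructor
  · intro g g' h
    obtain ⟨g, rfl⟩ := Quot.exists_rep g
    obtain ⟨g', rfl⟩ := Quot.exists_rep g'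
    have h' : Homotopic (ParamHom.const (𝟙_ SSet.{u}) (f ≫ g)).toMapSpace
        (ParamHom.const (𝟙_ SSet.{u}) (f ≫ g')).toMapSpace := by
      have key : ∀ a b : X ⟶ E, Relation.EqvGen HomotopyRel a b →
          Homotopic (ParamHom.const (𝟙_ SSet.{u}) a).toMapSpace
            (ParamHom.const (𝟙_ SSet.{u}) b).toMapSpace := by
        intro a b h
        induction h with
        | rel f g h => exact homotopyRel_iff_homotopic.1 h
        | refl _ => exact .refl _
        | symm _ _ _ ih => exact ih.symm
        | trans _ _ _ _ _ ih₁ ih₂ => exact ih₁.trans ih₂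
      exact key _ _ (Quot.eqvGen_exact h)
    have e₀ := h₁.comp_left (ParamHom.const (𝟙_ SSet.{u}) g).toMapSpace
    have e₁ := h₁.comp_left (ParamHom.const (𝟙_ SSet.{u}) g').toMapSpace
    rw [Category.comp_id] at e₀ e₁
    exact Quot.sound (homotopyRel_iff_homotopic.2 (e₀.symm.trans ((h'.comp_right G).trans e₁)))
  · intro g
    obtain ⟨g, rfl⟩ := Quot.exists_rep g
    obtain ⟨a, ha⟩ := exists_const_toMapSpace_eq ((ParamHom.const (𝟙_ SSet.{u}) g).toMapSpace ≫ G)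
    refine ⟨Quot.mk _ a, Quot.sound (homotopyRel_iff_homotopic.2 ?_)⟩
    have := h₂.comp_left (ParamHom.const (𝟙_ SSet.{u}) g).toMapSpace
    rw [Category.comp_id, ← Category.assoc, ← ha] at this
    exact this

theorem IsStableEquiv.comp {X Y Z : SymSpec.{u}} {f : X ⟶ Y} {g : Y ⟶ Z} (hf : IsStableEquiv f)
    (hg : IsStableEquiv g) : IsStableEquiv (f ≫ g) :=
  isStableEquiv_of_isWeakEquiv_mapSpacePre fun _ hE hE' =>
    (hg.isWeakEquiv_mapSpacePre hE hE').comp (hf.isWeakEquiv_mapSpacePre hE hE')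

theorem IsStableEquiv.of_comp_left {X Y Z : SymSpec.{u}} {f : X ⟶ Y} {g : Y ⟶ Z}
    (hf : IsStableEquiv f) (h : IsStableEquiv (f ≫ g)) : IsStableEquiv g :=
  isStableEquiv_of_isWeakEquiv_mapSpacePre fun _ hE hE' =>
    (hf.isWeakEquiv_mapSpacePre hE hE').of_comp_right (h.isWeakEquiv_mapSpacePre hE hE')

end SymSpec

namespace SymSpec

open PSSet SSet Simplicial HomotopicalAlgebra modelCategoryQuillen Limits

/-! ### Pushouts -/

theorem glue.hom_ext {A Y Z T : SymSpec.{u}} {f : A ⟶ Y} {g : A ⟶ Z} {p q : glue f g ⟶ T}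
    (h₁ : glue.inl f g ≫ p = glue.inl f g ≫ q) (h₂ : glue.inr f g ≫ p = glue.inr f g ≫ q) :
    p = q := by
  refine hom_ext_apply fun n k => ?_
  rintro ⟨y | z⟩
  · exact congr_ap h₁ n k y
  · exact congr_ap h₂ n k z

theorem isPushout_glue {A Y Z : SymSpec.{u}} (f : A ⟶ Y) (g : A ⟶ Z) :
    IsPushout f g (glue.inl f g) (glue.inr f g) :=
  IsPushout.of_isColimit' ⟨glue.condition f g⟩ (PushoutCocone.IsColimit.mk _
    (fun s => glue.desc s.inl s.inr s.condition) (fun _ => rfl) (fun _ => rfl)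
    (fun _ _ h₁ h₂ => glue.hom_ext h₁ h₂))

/-- Mapping spaces take pushouts to pullbacks. -/
theorem isPullback_mapSpacePre {A Y Z V : SymSpec.{u}} {f : A ⟶ Y} {g : A ⟶ Z} {y : Y ⟶ V}
    {z : Z ⟶ V} (sq : IsPushout f g y z) (E : SymSpec.{u}) :
    IsPullback (mapSpacePre y E) (mapSpacePre z E) (mapSpacePre f E) (mapSpacePre g E) := by
  have w : mapSpacePre y E ≫ mapSpacePre f E = mapSpacePre z E ≫ mapSpacePre g E :=
    congrArg (mapSpacePre · E) sq.w
  -- A map L → Map(X, E) is a map X → E ^ L, so a cone with apex L is a pair of maps to E ^ L that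
  -- agree on A and hence glue over the pushout.
  have h (s : PullbackCone (mapSpacePre f E) (mapSpacePre g E)) :
      f ≫ (ParamHom.ofMapSpace s.fst).toCotensor = g ≫ (ParamHom.ofMapSpace s.snd).toCotensor := by
    rw [← ParamHom.pre_toCotensor, ← ParamHom.pre_toCotensor]
    exact congrArg (fun F => (ParamHom.ofMapSpace F).toCotensor) s.condition
  have fac {X : SymSpec.{u}} {L : SSet.{u}} (x : X ⟶ V) (χ : V ⟶ E.cotensor L)
      (F : L ⟶ mapSpace X E) (hχ : x ≫ χ = (ParamHom.ofMapSpace F).toCotensor) :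
      (ParamHom.ofCotensor χ).toMapSpace ≫ mapSpacePre x E = F := by
    have := congrArg (fun a => (ParamHom.ofCotensor a).toMapSpace) hχ
    rw [ParamHom.ofCotensor_toCotensor, ParamHom.toMapSpace_ofMapSpace] at this
    exact this
  refine IsPullback.of_isLimit' ⟨w⟩ (PullbackCone.IsLimit.mk _
    (fun s => (ParamHom.ofCotensor (sq.desc _ _ (h s))).toMapSpace)
    (fun s => fac _ _ _ (sq.inl_desc _ _ (h s))) (fun s => fac _ _ _ (sq.inr_desc _ _ (h s)))
    (fun s m h₁ h₂ => ?_))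
  have e : (ParamHom.ofMapSpace m).toCotensor = sq.desc _ _ (h s) := by
    refine sq.hom_ext ?_ ?_
    · rw [sq.inl_desc, ← ParamHom.pre_toCotensor, ← h₁]
      rfl
    · rw [sq.inr_desc, ← ParamHom.pre_toCotensor, ← h₂]
      rfl
  rw [← e, ParamHom.ofCotensor_toCotensor, ParamHom.toMapSpace_ofMapSpace]

/-- A cobase change of a levelwise injective stable equivalence is a stable equivalence. -/
theorem IsStableEquiv.of_isPushout_of_injective {A Y Z V : SymSpec.{u}} {f : A ⟶ Y} {g : A ⟶ Z}
    {y : Y ⟶ V} {z : Z ⟶ V} (sq : IsPushout f g y z) (hf : IsStableEquiv f)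
    (hf' : ∀ n k, Function.Injective (ap f n k)) : IsStableEquiv z :=
  isStableEquiv_of_isWeakEquiv_mapSpacePre fun E hE hE' => by
    have := hE.kanComplex_mapSpace A
    have := hE.kanComplex_mapSpace Y
    have := hE.fibration_mapSpacePre f hf'
    exact isWeakEquiv_of_rlp_monomorphisms (MorphismProperty.of_isPullback
      (isPullback_mapSpacePre sq E) (hf.isWeakEquiv_mapSpacePre hE hE').rlp_monomorphisms)

/-- A cobase change of a stable equivalence along a levelwise injective map is a stable
equivalence. -/
theorem IsStableEquiv.of_isPushout {A Y Z V : SymSpec.{u}} {f : A ⟶ Y} {g : A ⟶ Z} {y : Y ⟶ V}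
    {z : Z ⟶ V} (sq : IsPushout f g y z) (hf : ∀ n k, Function.Injective (ap f n k))
    (hg : IsStableEquiv g) : IsStableEquiv y :=
  isStableEquiv_of_isWeakEquiv_mapSpacePre fun E hE hE' => by
    have := hE.kanComplex_mapSpace A
    have := hE.kanComplex_mapSpace Y
    have := hE.kanComplex_mapSpace Z
    have := hE.fibration_mapSpacePre f hf
    exact isWeakEquiv_of_isPullback (hg.isWeakEquiv_mapSpacePre hE hE')
      (isPullback_mapSpacePre sq E)

/-! ### Injectivity -/

open Classical in
theorem glue.inr_injective {A Y Z : SymSpec.{u}} {f : A ⟶ Y} (g : A ⟶ Z)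
    (hf : ∀ n k, Function.Injective (ap f n k)) (n : ℕ) (k : SimplexCategoryᵒᵖ) :
    Function.Injective (ap (glue.inr f g) n k) := by
  intro z z' h
  -- A partial retraction onto Z: a simplex `f a` goes to `g a`, which is unambiguous as `f` is
  -- injective, and the rest of Y goes to `none`.
  let G : (Y.lvl n).S k ⊕ (Z.lvl n).S k → Option ((Z.lvl n).S k) :=
    Sum.elim (fun y => if h : ∃ a, ap f n k a = y then some (ap g n k h.choose) else none) some
  have hG : ∀ p q, GlueRel (Hom.lvl f n) (Hom.lvl g n) k p q → G p = G q := by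
    rintro _ _ ⟨a⟩
    have ha : ∃ a', ap f n k a' = ap f n k a := ⟨a, rfl⟩
    change (if h : ∃ a', ap f n k a' = ap f n k a then some (ap g n k h.choose) else none) =
      some (ap g n k a)
    rw [dif_pos ha, hf n k ha.choose_spec]
  exact Option.some.inj (congrArg (Quot.lift G hG) h)

theorem glue.inl_injective {A Y Z : SymSpec.{u}} (f : A ⟶ Y) {g : A ⟶ Z}
    (hg : ∀ n k, Function.Injective (ap g n k)) (n : ℕ) (k : SimplexCategoryᵒᵖ) :
    Function.Injective (ap (glue.inl f g) n k) := fun _ _ h =>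
  glue.inr_injective f hg n k
    (congrArg (ap (glue.desc (glue.inr g f) (glue.inl g f) (glue.condition g f).symm) n k) h)

theorem const_zero_ne_pt (k : SimplexCategoryᵒᵖ) :
    (stdSimplex.const 1 0 k : interval.{u}.S k) ≠ interval.pt k :=
  fun h => zero_ne_one (const_inj h)

theorem coneIncl_injective (X : SymSpec.{u}) (n : ℕ) (k : SimplexCategoryᵒᵖ) :
    Function.Injective (ap (coneIncl X) n k) := by
  intro x y h
  rcases smash.mk_eq_mk h with ⟨h, -⟩ | ⟨h₁ | h₁, h₂ | h₂⟩
  · exact h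
  · exact h₁.trans h₂.symm
  all_goals exact absurd ‹_› (const_zero_ne_pt k)

theorem eq_pt_of_ap_eq_pt {X Y : SymSpec.{u}} {f : X ⟶ Y} {n : ℕ} {k : SimplexCategoryᵒᵖ}
    (hf : Function.Injective (ap f n k)) {x : (X.lvl n).S k} (h : ap f n k x = (Y.lvl n).pt k) :
    x = (X.lvl n).pt k :=
  hf (h.trans (PSSet.Hom.app_pt (Hom.lvl f n) k).symm)

theorem _root_.PSSet.smash.mk_eq_pt {X K : PSSet.{u}} {k : SimplexCategoryᵒᵖ} {x : X.S k}
    {a : K.S k} (h : x = X.pt k ∨ a = K.pt k) : PSSet.smash.mk x a = (PSSet.smash X K).pt k := by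
  rcases h with rfl | rfl
  · exact smash.mk_pt_left a
  · exact smash.mk_pt_right x

/-- The map from the union of `Y` and the cone of `X` to the cone of `Y`. -/
def coneUnionDesc {X Y : SymSpec.{u}} (j : X ⟶ Y) : cofiber j ⟶ Y.smash interval :=
  glue.desc (coneIncl Y) (smashMap j interval) rfl

theorem coneUnionDesc_injective {X Y : SymSpec.{u}} {j : X ⟶ Y}
    (hj : ∀ n k, Function.Injective (ap j n k)) (n : ℕ) (k : SimplexCategoryᵒᵖ) :
    Function.Injective (ap (coneUnionDesc j) n k) := by
  -- The mixed case: the base of CY meets the image of CX only in the base of CX, where the two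
  -- pieces are already glued, and at the base point.
  have key : ∀ (y : (Y.lvl n).S k) (x : (X.lvl n).S k) (s : interval.{u}.S k),
      smash.mk y (stdSimplex.const 1 0 k : interval.{u}.S k) = smash.mk (ap j n k x) s →
      ap (glue.inl j (coneIncl X)) n k y = ap (glue.inr j (coneIncl X)) n k (smash.mk x s) := by
    intro y x s h
    rcases smash.mk_eq_mk h with ⟨rfl, rfl⟩ | ⟨h₁ | h₁, h₂⟩
    · exact congr_ap (glue.condition j (coneIncl X)) n k x
    · rw [h₁, smash.mk_eq_pt (h₂.imp_left (eq_pt_of_ap_eq_pt (hj n k)))]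
      exact (PSSet.Hom.app_pt (Hom.lvl (glue.inr j (coneIncl X)) n) k).symm
    · exact absurd h₁ (const_zero_ne_pt k)
  rintro ⟨y | ⟨x, s⟩⟩ ⟨y' | ⟨x', s'⟩⟩ h
  · exact congrArg (ap (glue.inl j (coneIncl X)) n k) (coneIncl_injective Y n k h)
  · exact key y x' s' h
  · exact (key y' x s h.symm).symm
  · refine congrArg (ap (glue.inr j (coneIncl X)) n k) (?_ : smash.mk x s = smash.mk x' s')
    rcases smash.mk_eq_mk (x := ap j n k x) (y := ap j n k x') h with ⟨h₁, h₂⟩ | ⟨h₁, h₂⟩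
    · exact congrArg₂ smash.mk (hj n k h₁) h₂
    · rw [smash.mk_eq_pt (h₁.imp_left (eq_pt_of_ap_eq_pt (hj n k))),
        smash.mk_eq_pt (h₂.imp_left (eq_pt_of_ap_eq_pt (hj n k)))]

/-! ### Contractibility of cones -/

/-- The unique map `X ⟶ *`. -/
def toPoint (X : SymSpec.{u}) : X ⟶ point where
  lvl _ := homMk (fun _ _ => PUnit.unit) (fun _ _ => rfl) (fun _ => rfl)
  lvl_act _ _ _ _ := rfl
  lvl_susp _ _ _ _ := rfl

theorem fromPoint_comp {X Y : SymSpec.{u}} (f : X ⟶ Y) : fromPoint X ≫ f = fromPoint Y :=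
  hom_ext_apply fun n k _ => PSSet.Hom.app_pt (Hom.lvl f n) k

/-- A homotopy of maps `X ⟶ Y` induces a homotopy of maps of mapping spaces. -/
theorem homotopic_mapSpacePre {X Y : SymSpec.{u}} (H : ParamHom X Δ1 Y) (E : SymSpec.{u}) :
    Homotopic (mapSpacePre (H.atVertex 0) E) (mapSpacePre (H.atVertex 1) E) := by
  let G (k : SimplexCategoryᵒᵖ) (φ : ParamHom Y (coyoneda.obj (Opposite.op k)) E) (t : Δ1.obj k) :
      ParamHom X (coyoneda.obj (Opposite.op k)) E :=
    { app := fun n l x θ => φ.app n l (H.app n l x (Δ1.map θ t)) θ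
      app_map := fun n l m η x θ => by
        refine Eq.trans ?_ (φ.app_map n η (H.app n l x (Δ1.map θ t)) θ)
        rw [← H.app_map, ← Functor.map_comp_apply]
        rfl
      app_pt := fun n l θ => by rw [H.app_pt, φ.app_pt]
      app_act := fun n π l x θ => by rw [H.app_act, φ.app_act]
      app_susp := fun l n x t θ => by rw [H.app_susp, φ.app_susp] }
  refine ⟨SSet.ofFun (X := mapSpace Y E ⊗ Δ1) (Y := mapSpace X E) (fun k p => G k p.1 p.2) ?_, rfl,
    rfl⟩
  intro k l θ p
  refine ParamHom.ext_apply fun n m x η => ?_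
  exact congrArg (fun s => (p.1 : ParamHom Y (coyoneda.obj (Opposite.op k)) E).app n m
    (H.app n m x s) (θ ≫ η)) (Functor.map_comp_apply Δ1 θ η p.2).symm

/-- The maximum of two simplices of `Δ[1]`. -/
def maxSimplex {k : SimplexCategoryᵒᵖ} (s t : Δ1.{u}.obj k) : Δ1.{u}.obj k :=
  stdSimplex.objEquiv.symm (SimplexCategory.Hom.mk
    (stdSimplex.asOrderHom s ⊔ stdSimplex.asOrderHom t))

theorem maxSimplex_const_zero {k : SimplexCategoryᵒᵖ} (s : Δ1.{u}.obj k) :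
    maxSimplex s (stdSimplex.const 1 0 k) = s := by
  refine stdSimplex.objEquiv.injective (SimplexCategory.Hom.ext _ _ (OrderHom.ext _ _ (funext
    fun m => ?_)))
  exact max_eq_left (Fin.zero_le _)

theorem maxSimplex_const_one {k : SimplexCategoryᵒᵖ} (s : Δ1.{u}.obj k) :
    maxSimplex s (stdSimplex.const 1 1 k) = stdSimplex.const 1 1 k := by
  refine stdSimplex.objEquiv.injective (SimplexCategory.Hom.ext _ _ (OrderHom.ext _ _ (funext
    fun m => ?_)))
  exact max_eq_right (Fin.le_last _)

theorem maxSimplex_const_one_left {k : SimplexCategoryᵒᵖ} (s : Δ1.{u}.obj k) :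
    maxSimplex (stdSimplex.const 1 1 k) s = stdSimplex.const 1 1 k := by
  refine stdSimplex.objEquiv.injective (SimplexCategory.Hom.ext _ _ (OrderHom.ext _ _ (funext
    fun m => ?_)))
  exact max_eq_left (Fin.le_last _)

/-- The contraction of the cone of `X`. -/
def coneContraction (X : SymSpec.{u}) : ParamHom (X.smash interval) Δ1 (X.smash interval) where
  app n k z t := PSSet.smash.lift (fun x s => smash.mk (K := interval) x (maxSimplex s t))
    ((PSSet.smash (X.lvl n) interval).pt k) (fun _ => smash.mk_pt_left _)
    (fun x => (congrArg (smash.mk (K := interval) x) (maxSimplex_const_one_left t)).trans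
      (smash.mk_pt_right x)) z
  app_map := by
    rintro n k l θ ⟨x, s⟩ t
    rfl
  app_pt n k t := smash.mk_pt_left _
  app_act := by
    rintro n π k ⟨x, s⟩ t
    rfl
  app_susp := by
    rintro k n ⟨x, s⟩ t r
    rfl

/-- The map (s, t) ↦ max(s, t) contracts Δ[1] to its base point 1, and Map(-, E) turns the resulting
contraction of the cone into a homotopy. -/
theorem isStableEquiv_fromPoint_cone (X : SymSpec.{u}) :
    IsStableEquiv (fromPoint (X.smash interval)) :=
  isStableEquiv_of_isWeakEquiv_mapSpacePre fun E hE _ => by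
    have := hE.kanComplex_mapSpace (X.smash interval)
    refine isWeakEquiv_of_homotopic _ (mapSpacePre (toPoint _) E) (Homotopic.symm ?_) (.refl _)
    have h := homotopic_mapSpacePre (coneContraction X) E
    have e₀ : (coneContraction X).atVertex 0 = 𝟙 _ := by
      refine hom_ext_apply fun n k => ?_
      rintro ⟨x, s⟩
      exact congrArg (smash.mk (K := interval) x) (maxSimplex_const_zero s)
    have e₁ : (coneContraction X).atVertex 1 = toPoint _ ≫ fromPoint _ := by
      refine hom_ext_apply fun n k => ?_
      rintro ⟨x, s⟩
      exact (congrArg (smash.mk (K := interval) x) (maxSimplex_const_one s)).trans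
        (smash.mk_pt_right x)
    rw [e₀, e₁] at h
    exact h

theorem isStableEquiv_toPoint_cone (X : SymSpec.{u}) :
    IsStableEquiv (toPoint (X.smash interval)) :=
  (isStableEquiv_fromPoint_cone X).of_comp_left
    (isStableEquiv_of_isWeakEquiv_mapSpacePre fun _ _ _ =>
      isWeakEquiv_of_homotopic _ (𝟙 _) (.refl _) (.refl _))

/-- No hypothesis on `f` is needed, because both cones are contractible. -/
theorem isStableEquiv_smashMap_interval {X Y : SymSpec.{u}} (f : X ⟶ Y) :
    IsStableEquiv (smashMap f interval) :=
  (isStableEquiv_fromPoint_cone X).of_comp_left (by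
    rw [fromPoint_comp]
    exact isStableEquiv_fromPoint_cone Y)

/-- If `j` is a levelwise injective stable equivalence, so is the map from the union of `Y` and the
cone of `X` to the cone of `Y`. -/
theorem isStableEquiv_coneUnionDesc {X Y : SymSpec.{u}} {j : X ⟶ Y}
    (hj : ∀ n k, Function.Injective (ap j n k)) (hj' : IsStableEquiv j) :
    IsStableEquiv (coneUnionDesc j) :=
  (IsStableEquiv.of_isPushout_of_injective (isPushout_glue j (coneIncl X)) hj' hj).of_comp_left
    (isStableEquiv_smashMap_interval j)

/-! ### The suspension as a quotient of the cone -/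

/-- The quotient map `Δ[1] ⟶ S¹`. -/
def intervalToCircle : interval.{u} ⟶ circle.{u} :=
  homMk (fun _ s => Quot.mk _ s) (fun _ _ => rfl)
    (fun _ => Quot.sound ⟨mem_boundary_one.2 ⟨1, rfl⟩, mem_boundary_one.2 ⟨0, rfl⟩⟩)

/-- A map out of the suspension, from a map on the cone that is trivial on the base. -/
def suspensionDesc {X T : SymSpec.{u}} (p : X.smash interval ⟶ T)
    (h : coneIncl X ≫ p = toPoint X ≫ fromPoint T) : suspension X ⟶ T := by
  -- Both ends of Δ[1] go to the base point: the vertex 0 by `h`, and the vertex 1 because it is the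
  -- base point of the interval.
  have hb : ∀ n k (x : (X.lvl n).S k) (s : Δ1.{u}.obj k), s ∈ (boundary.{u} 1).obj k →
      ap p n k (smash.mk (K := interval) x s) = (T.lvl n).pt k := by
    intro n k x s hs
    obtain ⟨ε, rfl⟩ := mem_boundary_one.1 hs
    fin_cases ε
    · exact congr_ap h n k x
    · exact (congrArg (ap p n k) (smash.mk_pt_right x)).trans (PSSet.Hom.app_pt (Hom.lvl p n) k)
  exact
    { lvl := fun n => homMk (fun k => PSSet.smash.lift
          (fun x => Quot.lift (fun s => ap p n k (smash.mk (K := interval) x s))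
            (fun s t hst => (hb n k x s hst.1).trans (hb n k x t hst.2).symm))
          ((T.lvl n).pt k)
          (by
            rintro ⟨s⟩
            exact (congrArg (ap p n k) (smash.mk_pt_left (K := interval) s)).trans
              (PSSet.Hom.app_pt (Hom.lvl p n) k))
          (fun x => hb n k x _ (mem_boundary_one.2 ⟨0, rfl⟩)))
        (by
          rintro k l θ ⟨x, ⟨s⟩⟩
          exact PSSet.Hom.ap_map (Hom.lvl p n) θ (smash.mk (K := interval) x s))
        (fun k => hb n k _ _ (mem_boundary_one.2 ⟨0, rfl⟩))
      lvl_act := by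
        rintro n π k ⟨x, ⟨s⟩⟩
        exact Hom.lvl_act p n π k (smash.mk (K := interval) x s)
      lvl_susp := by
        rintro k n ⟨x, ⟨s⟩⟩ t
        exact Hom.lvl_susp p k n (smash.mk (K := interval) x s) t }

theorem isPushout_suspension (X : SymSpec.{u}) :
    IsPushout (coneIncl X) (toPoint X) (X.smashMapRight intervalToCircle)
      (fromPoint (suspension X)) := by
  have w : coneIncl X ≫ X.smashMapRight intervalToCircle = toPoint X ≫ fromPoint _ :=
    hom_ext_apply fun n k x => smash.mk_pt_right (K := circle) x
  have hpt {T : SymSpec.{u}} (f : point ⟶ T) : f = fromPoint T :=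
    (Category.id_comp f).symm.trans (fromPoint_comp f)
  refine IsPushout.of_isColimit' ⟨w⟩ (PushoutCocone.IsColimit.mk _
    (fun s => suspensionDesc s.inl (by rw [s.condition, hpt s.inr])) (fun s => ?_)
    (fun s => (fromPoint_comp _).trans (hpt _).symm) (fun s m h₁ h₂ => ?_))
  · refine hom_ext_apply fun n k => ?_
    rintro ⟨x, t⟩
    rfl
  · refine hom_ext_apply fun n k => ?_
    rintro ⟨x, ⟨t⟩⟩
    exact congr_ap h₁ n k (smash.mk (K := interval) x t)

/-! ### The total cofiber -/

variable {M₀₀ M₀₁ M₁₀ M₁₁ : SymSpec.{u}}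

/-- The inclusion of a complement of `β` is equivalent to the homotopy cofiber of `β`. -/
theorem isStableEquiv_comp_inl_cofiber (β : M₀₀ ⟶ M₁₀) (s : M₁₁ ⟶ M₁₀)
    (hβs : IsStableEquiv (wedgeDesc β s)) :
    IsStableEquiv (s ≫ glue.inl β (coneIncl M₀₀)) := by
  let i : M₀₀ ⟶ wedge M₀₀ M₁₁ := glue.inl _ _
  have sq := isPushout_glue i (coneIncl M₀₀)
  have sqβ : IsPushout (i ≫ wedgeDesc β s) (coneIncl M₀₀) (glue.inl β (coneIncl M₀₀))
    (glue.inr β (coneIncl M₀₀)) := isPushout_glue β (coneIncl M₀₀)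
  have h₁ := IsStableEquiv.of_isPushout (IsPushout.of_left' sqβ sq).flip
    (glue.inl_injective _ (coneIncl_injective M₀₀)) hβs
  -- The cofiber of `i` is CM₀₀ ∨ M₁₁, so the inclusion of M₁₁ is a cobase change of * → CM₀₀.
  have sq' := (isPushout_glue (fromPoint M₀₀) (fromPoint M₁₁)).flip.paste_vert sq
  rw [fromPoint_comp] at sq'
  have h₂ := IsStableEquiv.of_isPushout_of_injective sq'.flip (isStableEquiv_fromPoint_cone M₀₀)
    (fun _ _ _ _ _ => rfl)
  have h := h₂.comp h₁
  rw [Category.assoc, sq.inl_desc, ← Category.assoc] at h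
  exact h

/-- The cofiber of the inclusion of `M₁₁` in the cofiber of `δ` is equivalent to the total
cofiber. -/
theorem exists_isStableEquiv_cofiber₂ (α : M₀₀ ⟶ M₀₁) (β : M₀₀ ⟶ M₁₀) (γ : M₁₀ ⟶ M₁₁)
    (δ : M₀₁ ⟶ M₁₁) (comm : β ≫ γ = α ≫ δ) (s : M₁₁ ⟶ M₁₀) (hs : s ≫ γ = 𝟙 M₁₁)
    (hβs : IsStableEquiv (wedgeDesc β s)) :
    ∃ f : cofiber (glue.inl δ (coneIncl M₀₁)) ⟶ cofiber₂ α β γ δ comm, IsStableEquiv f := by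
  let c := cofiberMap β δ α γ comm
  let j := s ≫ glue.inl β (coneIncl M₀₀)
  have hjc : j ≫ c = glue.inl δ (coneIncl M₀₁) :=
    (congrArg (· ≫ glue.inl δ (coneIncl M₀₁)) hs).trans (Category.id_comp _)
  -- The section `s` is injective because `γ` is a left inverse of it.
  have hj : ∀ n k, Function.Injective (ap j n k) := fun n k =>
    (glue.inl_injective β (coneIncl_injective M₀₀) n k).comp
      (Function.LeftInverse.injective (g := ap γ n k) (congr_ap hs n k))
  let i := glue.inl δ (coneIncl M₀₁)
  have sq₁ : IsPushout (j ≫ c) (coneIncl M₁₁) (glue.inl i (coneIncl M₁₁))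
      (glue.inr i (coneIncl M₁₁)) := by
    rw [hjc]
    exact isPushout_glue _ _
  have sq₂ := IsPushout.of_left' sq₁ (isPushout_glue j (coneIncl M₁₁))
  -- The cone inclusion of C(β) factors through C(j). Hence C(j ≫ c) → C(c) is a cobase change of
  -- C(j) → C(C(β)), the map from the union of C(β) and CM₁₁ to the cone on C(β).
  have sq₃ : IsPushout c (glue.inl j (coneIncl M₁₁) ≫ coneUnionDesc j)
    (glue.inl c (coneIncl (cofiber β))) (glue.inr c (coneIncl (cofiber β))) := isPushout_glue c _
  exact ⟨_, IsStableEquiv.of_isPushout_of_injective (IsPushout.of_top' sq₃ sq₂).flip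
    (isStableEquiv_coneUnionDesc hj (isStableEquiv_comp_inl_cofiber β s hβs))
    (coneUnionDesc_injective hj)⟩

/-- The cofiber of the inclusion of `Y` in the cofiber of `δ : X ⟶ Y` is equivalent to the
suspension of `X`. -/
theorem exists_isStableEquiv_suspension {X Y : SymSpec.{u}} (δ : X ⟶ Y) :
    ∃ f : cofiber (glue.inl δ (coneIncl X)) ⟶ suspension X, IsStableEquiv f := by
  -- Pasting the two gluings exhibits the iterated cofiber as CX ∪ CY, glued along X; replacing CY
  -- by a point gives ΣX.
  have sq := (isPushout_glue δ (coneIncl X)).flip.paste_vert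
    (isPushout_glue (glue.inl δ (coneIncl X)) (coneIncl Y))
  have sq' : IsPushout (coneIncl X) ((δ ≫ coneIncl Y) ≫ toPoint _)
    (X.smashMapRight intervalToCircle) (fromPoint (suspension X)) := isPushout_suspension X
  exact ⟨_, IsStableEquiv.of_isPushout (IsPushout.of_top' sq' sq)
    (glue.inr_injective _ (glue.inl_injective δ (coneIncl_injective X)))
    (isStableEquiv_toPoint_cone Y)⟩

end SymSpec
end

theorem lemma5p1 {M₀₀ M₀₁ M₁₀ M₁₁ : SymSpec.{u}}
    (α : M₀₀ ⟶ M₀₁) (β : M₀₀ ⟶ M₁₀) (γ : M₁₀ ⟶ M₁₁) (δ : M₀₁ ⟶ M₁₁)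
    (comm : β ≫ γ = α ≫ δ)
    (s : M₁₁ ⟶ M₁₀) (hs : s ≫ γ = 𝟙 M₁₁)
    (hβs : SymSpec.IsStableEquiv (SymSpec.wedgeDesc β s)) :
    SymSpec.Equivalent (SymSpec.cofiber₂ α β γ δ comm) (SymSpec.suspension M₀₁) :=
  -- Both equivalences start at the cofiber of M₁₁ → C(δ), so the first one is reversed.
  .trans _ _ _
    (.symm _ _ (.rel _ _ (SymSpec.exists_isStableEquiv_cofiber₂ α β γ δ comm s hs hβs)))
    (.rel _ _ (SymSpec.exists_isStableEquiv_suspension δ))
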